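/- \textbf{Setting.} Constants form a countably infinite set $\mathsf{Cons}$; an instance is a finite set of facts over $\mathsf{Cons}$. Let $\mathbf S$ and $\mathbf T$ be disjoint source and target schemas. An \emph{annotated bidirectional dependency} (abd) is a sentence $\forall \bar x\,(\exists \bar y\,\alpha(\bar x,\bar y)\leftrightarrow\exists\bar z\,\beta(\bar x,\bar z))$, where $\alpha$ is a conjunction of atoms over $\mathbf S$ and $\beta$ a conjunction of atoms over $\mathbf T$, each annotated with an integer; an \emph{annotated equality-generating dependency} (aegd) is a sentence $\forall\bar x\,(\alpha(\bar x)\to x=x')$ with $\alpha$ a conjunction of annotated target atoms in which $x,x'$ occur. Let $\Sigma^{\leftrightarrow}$ be a finite set of abds and aegds. Its \emph{annotation density} is the maximum, over target symbols $R$ and integers $i$, of the number of occurrences of $R^i$ in the abds. A position of $R^i$ is \emph{affected} if a variable from $\bar z$ stands there in some abd. An aegd is \emph{safe} if every variable that occurs at least twice in its body occurs only in non-affected positions. For a target instance $J$ and a map $\ell$ assigning to each fact of $J$ a nonempty set of integers, let $J_\ell$ be the set of facts $R_i(\bar a)$ with $R(\bar a)\in J$ and $i\in\ell(R(\bar a))$;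 an annotated atom $R^i(\bar u)$ is read as an atom over $R_i$. $J$ is an \emph{ABD-solution} for a source instance $I$ and $\Sigma^{\leftrightarrow}$ if for some $\ell$: $(I,J_\ell)\models\Sigma^{\leftrightarrow}$, and for every $R_i(\bar a)\in J_\ell$ there are $I'\subseteq I$ and $J'\subseteq J_\ell$ with $R_i(\bar a)\in J'$, $(I',J')\models\Sigma^{\leftrightarrow}$ and $(I',J'')\not\models\Sigma^{\leftrightarrow}$ for all $J''\subsetneq J'$. A \emph{semi-na\"ive table} $T$ is a finite set of facts over constants, \emph{open} nulls and \emph{closed} nulls; a \emph{global condition} $\varphi^*$ is a conjunction of disjunctions of unequalities $x\ne y$ between elements of $T$. Given a valuation $v$ of the closed nulls and valuations $v_1,\dots,v_n$ of the open nulls by constants, $(v,\{v_1,\dots,v_n\})$ satisfies $x\neq y$ if, for all $i,j\le n$, the value of $x$ under $v,v_i$ differs from the value of $y$ under $v,v_j$ (constants having themselves as value); this extends to disjunctions and conjunctions as usual. $\mathrm{Rep}(T,\varphi^*)$ is the set of all instances $v(v_1(T)\cup\dots\cup v_n(T))$ with $n\ge1$ and $(v,\{v_1,\dots,v_n\})\models\varphi^*$.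 $(T,\varphi^*)$ is a \emph{universal representative} for $I$ and $\Sigma^{\leftrightarrow}$ if $T$ is over $\mathbf T$ and $\mathrm{Rep}(T,\varphi^*)$ is the set of all ABD-solutions for $I$ and $\Sigma^{\leftrightarrow}$. A \emph{universal query} is $q(\bar x):=\forall\bar y\,\beta(\bar x,\bar y)$ with $\beta$ a quantifier-free first-order formula, in which constants are allowed, over $\mathbf T$; variables range over $\mathsf{Cons}$. \textbf{Theorem.} There is an algorithm such that for every universal query $q$ there is a polynomial $p_q$ with the following property. Let $(T,\varphi^*)$ be a universal representative for some source instance $I$ and some set $\Sigma^{\leftrightarrow}$ of abds and safe aegds with annotation density $1$ whose target schema contains the relation symbols of $q$, and let $\bar t$ be a tuple of constants whose length is the arity of $q$. Then the algorithm, run for the query $q$ on the input $((T,\varphi^*),\bar t)$, decides in time at most $p_q$ of the size of $((T,\varphi^*),\bar t)$ whether $\bar t\in\bigcap_{J\in\mathrm{Rep}(T,\varphi^*)}q(J)$. -/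

import Mathlib

/-! # Data exchange with annotated bidirectional dependencies: definitions -/

namespace DataExchange

/-! ## Schemas, facts, instances

Constants, variables and relation symbols are natural numbers. -/

/-- The countably infinite set of constants. -/
abbrev Cons : Type := ℕ

/-- A schema: finitely many relation symbols, each with an arity (read only on `syms`). -/
structure Schema where
  syms : Finset ℕ
  arity : ℕ → ℕ

/-- A fact `R(a₁, …, aₙ)` with entries in `α`. -/
structure Fact (α : Type) where
  rel : ℕ
  args : List α

/-- The relation symbol belongs to the schema and the number of entries is its arity. -/
def Fact.Over {α : Type} (S : Schema) (f : Fact α) : Prop :=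
  f.rel ∈ S.syms ∧ f.args.length = S.arity f.rel

/-- Apply a map to every entry of a fact. -/
def Fact.map {α β : Type} (g : α → β) (f : Fact α) : Fact β :=
  ⟨f.rel, f.args.map g⟩

/-- `J` is a (finite, ground) instance over the schema `S`. -/
def IsInstance (S : Schema) (J : Set (Fact Cons)) : Prop :=
  J.Finite ∧ ∀ f ∈ J, f.Over S

/-- A term: a variable or a constant. -/
inductive Term where
  | var (x : ℕ)
  | const (a : Cons)
  deriving DecidableEq

/-- The value of a term under an assignment of constants to the variables. -/
def Term.val (ν : ℕ → Cons) : Term → Cons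
  | .var x => ν x
  | .const a => a

/-- A relational atom. -/
structure Atom where
  rel : ℕ
  args : List Term
  deriving DecidableEq

/-- The fact that an atom becomes under an assignment. -/
def Atom.inst (ν : ℕ → Cons) (A : Atom) : Fact Cons :=
  ⟨A.rel, A.args.map (Term.val ν)⟩

def Atom.Over (S : Schema) (A : Atom) : Prop :=
  A.rel ∈ S.syms ∧ A.args.length = S.arity A.rel

/-! ## Annotated dependencies -/

/-- A relational atom annotated with an integer. -/
structure AnnAtom where
  rel : ℕ
  ann : ℤ
  args : List Term
  deriving DecidableEq

/-- A fact annotated with an integer: the fact `R_i(a)` over the schema that has one relation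
symbol `R_i` for each pair of a relation symbol `R` and an annotation `i`. -/
structure AnnFact where
  rel : ℕ
  ann : ℤ
  args : List Cons

def AnnAtom.inst (ν : ℕ → Cons) (A : AnnAtom) : AnnFact :=
  ⟨A.rel, A.ann, A.args.map (Term.val ν)⟩

def AnnAtom.Over (S : Schema) (A : AnnAtom) : Prop :=
  A.rel ∈ S.syms ∧ A.args.length = S.arity A.rel

/-- An annotated bidirectional dependency `∀ x, (∃ y, α(x,y)) ↔ (∃ z, β(x,z))`, where `α = body` is
a conjunction of source atoms and `β = head` a conjunction of annotated target atoms. The vector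
`x` consists of the variables that `α` and `β` share, `y` and `z` of the remaining ones. -/
structure Abd where
  body : List Atom
  head : List AnnAtom
  deriving DecidableEq

def Abd.InBody (ξ : Abd) (x : ℕ) : Prop := ∃ A ∈ ξ.body, Term.var x ∈ A.args

def Abd.InHead (ξ : Abd) (x : ℕ) : Prop := ∃ A ∈ ξ.head, Term.var x ∈ A.args

/-- The assignments `ν` and `μ` agree on the vector `x` of shared variables. -/
def Abd.Agree (ξ : Abd) (ν μ : ℕ → Cons) : Prop :=
  ∀ x, ξ.InBody x → ξ.InHead x → μ x = ν x

/-- `(I, K)` satisfies the abd, for a source instance `I` and an annotated target instance `K`. -/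
def Abd.Sat (ξ : Abd) (I : Set (Fact Cons)) (K : Set AnnFact) : Prop :=
  ∀ ν : ℕ → Cons,
    (∃ μ, ξ.Agree ν μ ∧ ∀ A ∈ ξ.body, A.inst μ ∈ I) ↔
      (∃ μ, ξ.Agree ν μ ∧ ∀ A ∈ ξ.head, A.inst μ ∈ K)

/-- An annotated equality-generating dependency `∀ x, α(x) → lhs = rhs`. -/
structure Aegd where
  body : List AnnAtom
  lhs : ℕ
  rhs : ℕ
  deriving DecidableEq

def Aegd.InBody (ξ : Aegd) (x : ℕ) : Prop := ∃ A ∈ ξ.body, Term.var x ∈ A.args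

/-- The annotated target instance `K` satisfies the aegd. -/
def Aegd.Sat (ξ : Aegd) (K : Set AnnFact) : Prop :=
  ∀ ν : ℕ → Cons, (∀ A ∈ ξ.body, A.inst ν ∈ K) → ν ξ.lhs = ν ξ.rhs

/-- A source schema, a target schema and a finite set of abds and aegds. -/
structure Mapping where
  source : Schema
  target : Schema
  abds : Finset Abd
  aegds : Finset Aegd

/-- The two schemas are disjoint, the dependencies are over them, and the two variables that an
aegd equates occur in its body. -/
structure Mapping.WellFormed (M : Mapping) : Prop where
  disjoint : Disjoint M.source.syms M.target.syms
  abd_body : ∀ ξ ∈ M.abds, ∀ A ∈ ξ.body, A.Over M.source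
  abd_head : ∀ ξ ∈ M.abds, ∀ A ∈ ξ.head, A.Over M.target
  aegd_body : ∀ ξ ∈ M.aegds, ∀ A ∈ ξ.body, A.Over M.target
  aegd_vars : ∀ ξ ∈ M.aegds, ξ.InBody ξ.lhs ∧ ξ.InBody ξ.rhs

/-- The annotations used for the relation symbol `R` in the abds. -/
def Mapping.annots (M : Mapping) (R : ℕ) : Finset ℤ :=
  M.abds.biUnion fun ξ => ((ξ.head.filter fun A => A.rel = R).map AnnAtom.ann).toFinset

/-- The number of occurrences of `R` with annotation `i` in the abds. -/
def Mapping.occurrences (M : Mapping) (R : ℕ) (i : ℤ) : ℕ :=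
  ∑ ξ ∈ M.abds, ξ.head.countP fun A => A.rel = R ∧ A.ann = i

/-- The annotation density of the relation symbol `R`. -/
def Mapping.relDensity (M : Mapping) (R : ℕ) : ℕ :=
  (M.annots R).sup (M.occurrences R)

/-- The annotation density. -/
def Mapping.density (M : Mapping) : ℕ :=
  M.target.syms.sup M.relDensity

/-- The annotated position `(R^i, k)` (with `k` counted from `0`) is affected: in the head of some
abd, a variable that does not occur in the body of that abd stands there. -/
def Mapping.Affected (M : Mapping) (R : ℕ) (i : ℤ) (k : ℕ) : Prop :=
  ∃ ξ ∈ M.abds, ∃ A ∈ ξ.head, A.rel = R ∧ A.ann = i ∧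
    ∃ z, A.args[k]? = some (Term.var z) ∧ ¬ ξ.InBody z

/-- The aegd is safe: every variable that occurs at least twice in its body occurs there only in
positions that are not affected. -/
def Aegd.Safe (M : Mapping) (ξ : Aegd) : Prop :=
  ∀ y : ℕ, 2 ≤ (ξ.body.flatMap AnnAtom.args).count (Term.var y) →
    ∀ A ∈ ξ.body, ∀ k : ℕ, A.args[k]? = some (Term.var y) → ¬ M.Affected A.rel A.ann k

/-- All aegds are safe. -/
def Mapping.Safe (M : Mapping) : Prop := ∀ ξ ∈ M.aegds, ξ.Safe M

/-! ## ABD-semantics -/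

/-- `(I, K)` satisfies all dependencies, for a source instance `I` and an annotated target
instance `K`. -/
def Mapping.Sat (M : Mapping) (I : Set (Fact Cons)) (K : Set AnnFact) : Prop :=
  (∀ ξ ∈ M.abds, ξ.Sat I K) ∧ ∀ ξ ∈ M.aegds, ξ.Sat K

/-- The annotated instance `J_ℓ` given by an instance `J` and a tuple-labelling function `ℓ`. -/
def annotate (J : Set (Fact Cons)) (l : Fact Cons → Set ℤ) : Set AnnFact :=
  {g | (⟨g.rel, g.args⟩ : Fact Cons) ∈ J ∧ g.ann ∈ l ⟨g.rel, g.args⟩}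

/-- `J` is inferred from `I` and the mapping with the tuple-labelling function `ℓ`: together with
the source, the labelled instance satisfies the dependencies, and each of its annotated facts lies
in a part of it that is a subset-minimal model for some part of the source. -/
def Mapping.Inferred (M : Mapping) (I J : Set (Fact Cons)) (l : Fact Cons → Set ℤ) : Prop :=
  (∀ f ∈ J, (l f).Nonempty) ∧ M.Sat I (annotate J l) ∧
    ∀ g ∈ annotate J l, ∃ I' ⊆ I, ∃ J' ⊆ annotate J l,
      g ∈ J' ∧ M.Sat I' J' ∧ ∀ J'' ⊂ J', ¬ M.Sat I' J''

/-- The set of solutions for `I` under the ABD-semantics. -/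
def Mapping.Sol (M : Mapping) (I : Set (Fact Cons)) : Set (Set (Fact Cons)) :=
  {J | IsInstance M.target J ∧ ∃ l : Fact Cons → Set ℤ, M.Inferred I J l}

/-! ## Semi-naive tables with a global condition -/

/-- An element of a semi-naive table: a constant, an open null or a closed null. -/
inductive Elem where
  | const (a : Cons)
  | opn (k : ℕ)
  | clo (k : ℕ)
  deriving DecidableEq

/-- The value of an element under a valuation `v` of the closed nulls and a valuation `w` of the
open nulls. -/
def Elem.val (v w : ℕ → Cons) : Elem → Cons
  | .const a => a
  | .opn k => w k
  | .clo k => v k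

/-- A semi-naive table `T`, listed as finitely many facts, with a global condition `φ*`: a
conjunction of disjunctions of unequalities `e₁ ≠ e₂`. -/
structure CondTable where
  facts : List (Fact Elem)
  cond : List (List (Elem × Elem))

/-- The table is over the schema `S` and its condition is about elements that occur in it. -/
structure CondTable.Over (S : Schema) (T : CondTable) : Prop where
  facts_over : ∀ f ∈ T.facts, f.Over S
  cond_dom : ∀ d ∈ T.cond, ∀ e ∈ d,
    (∃ f ∈ T.facts, e.1 ∈ f.args) ∧ ∃ f ∈ T.facts, e.2 ∈ f.args

/-- `(v, {w₁, …, wₙ})` satisfies the unequality `e.1 ≠ e.2`. -/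
def SatNe {n : ℕ} (v : ℕ → Cons) (w : Fin n → ℕ → Cons) (e : Elem × Elem) : Prop :=
  ∀ i j : Fin n, e.1.val v (w i) ≠ e.2.val v (w j)

/-- `(v, {w₁, …, wₙ})` satisfies the global condition. -/
def CondTable.SatCond (T : CondTable) {n : ℕ} (v : ℕ → Cons) (w : Fin n → ℕ → Cons) : Prop :=
  ∀ d ∈ T.cond, ∃ e ∈ d, SatNe v w e

/-- The set of instances that `(T, φ*)` represents: all `v(w₁(T) ∪ … ∪ wₙ(T))` with `n` positive
and `(v, {w₁, …, wₙ})` satisfying `φ*`. -/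
def CondTable.Rep (T : CondTable) : Set (Set (Fact Cons)) :=
  {J | ∃ n : ℕ, 0 < n ∧ ∃ (v : ℕ → Cons) (w : Fin n → ℕ → Cons), T.SatCond v w ∧
    J = {g | ∃ i : Fin n, ∃ f ∈ T.facts, g = f.map (Elem.val v (w i))}}

/-- `(T, φ*)` is a universal representative for the source instance `I` and the mapping `M`. -/
def IsUniversalRepresentative (M : Mapping) (I : Set (Fact Cons)) (T : CondTable) : Prop :=
  T.Over M.target ∧ T.Rep = M.Sol I

/-! ## Universal queries -/

/-- Quantifier-free first-order formulas. -/
inductive QFFormula where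
  | rel (A : Atom)
  | eq (s t : Term)
  | neg (β : QFFormula)
  | and (β γ : QFFormula)
  | or (β γ : QFFormula)

def QFFormula.Holds (J : Set (Fact Cons)) (ν : ℕ → Cons) : QFFormula → Prop
  | .rel A => A.inst ν ∈ J
  | .eq s t => s.val ν = t.val ν
  | .neg β => ¬ β.Holds J ν
  | .and β γ => β.Holds J ν ∧ γ.Holds J ν
  | .or β γ => β.Holds J ν ∨ γ.Holds J ν

def QFFormula.Over (S : Schema) : QFFormula → Prop
  | .rel A => A.Over S
  | .eq _ _ => True
  | .neg β => β.Over S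
  | .and β γ => β.Over S ∧ γ.Over S
  | .or β γ => β.Over S ∧ γ.Over S

/-- A universal query `q(x) := ∀ y, β(x, y)` with `β` quantifier-free. The vector `x` consists of
the variables `0, …, arity - 1`, and all other variables belong to `y`. -/
structure UniversalQuery where
  arity : ℕ
  matrix : QFFormula

/-- The set `q(J)` of answers to `q` on `J`. -/
def UniversalQuery.answers (q : UniversalQuery) (J : Set (Fact Cons)) :
    Set (Fin q.arity → Cons) :=
  {t | ∀ ν : ℕ → Cons, (∀ i : Fin q.arity, ν i = t i) → q.matrix.Holds J ν}

def UniversalQuery.Over (S : Schema) (q : UniversalQuery) : Prop := q.matrix.Over S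

/-! ## The machine model: WHILE programs on binary trees

Data are binary trees without labels. A program reads one tree and returns one tree. The cost of a
run charges every operation for the size of the tree that it reads or copies, so that a run of cost
`k` can be simulated by a Turing machine in time polynomial in `k`; conversely a step of a Turing
machine costs an amount linear in the size of its configuration. Polynomial cost is therefore
polynomial time in the usual sense. -/

/-- Binary trees. -/
inductive Tree where
  | nil
  | cons (l r : Tree)

/-- The number of nodes of a tree. -/
def Tree.size : Tree → ℕ
  | .nil => 1
  | .cons l r => 1 + l.size + r.size

def Tree.hd : Tree → Tree
  | .nil => .nil
  | .cons l _ => l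

def Tree.tl : Tree → Tree
  | .nil => .nil
  | .cons _ r => r

/-- Programs. On input `x`,
* `id`, `nil`, `hd`, `tl` return `x`, the empty tree, the left and the right subtree of `x`;
* `comp f g` runs `f` on `x` and then `g` on the result;
* `pair f g` runs `f` and `g` on `x` and joins their results to one tree;
* `cond b f g` runs `b` on `x`, and then on `x` again `f` if the result was not `nil`, else `g`;
* `loop b f` is `while b(x) ≠ nil do x := f(x)`, and returns the final `x`. -/
inductive Prog where
  | id
  | nil
  | hd
  | tl
  | comp (f g : Prog)
  | pair (f g : Prog)
  | cond (b f g : Prog)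
  | loop (b f : Prog)

/-- `Runs P x y k`: on input `x` the program `P` halts with output `y` and with cost `k`. -/
inductive Runs : Prog → Tree → Tree → ℕ → Prop where
  | id (x : Tree) : Runs .id x x (1 + x.size)
  | nil (x : Tree) : Runs .nil x .nil (1 + x.size)
  | hd (x : Tree) : Runs .hd x x.hd (1 + x.size)
  | tl (x : Tree) : Runs .tl x x.tl (1 + x.size)
  | comp {f g : Prog} {x y z : Tree} {k m : ℕ} :
      Runs f x y k → Runs g y z m → Runs (.comp f g) x z (1 + k + m)
  | pair {f g : Prog} {x y z : Tree} {k m : ℕ} :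
      Runs f x y k → Runs g x z m → Runs (.pair f g) x (.cons y z) (1 + x.size + k + m)
  | condTrue {b f g : Prog} {x u v y : Tree} {k m : ℕ} :
      Runs b x (.cons u v) k → Runs f x y m → Runs (.cond b f g) x y (1 + x.size + k + m)
  | condFalse {b f g : Prog} {x y : Tree} {k m : ℕ} :
      Runs b x .nil k → Runs g x y m → Runs (.cond b f g) x y (1 + x.size + k + m)
  | loopStop {b f : Prog} {x : Tree} {k : ℕ} :
      Runs b x .nil k → Runs (.loop b f) x x (1 + x.size + k)
  | loopStep {b f : Prog} {x u v y z : Tree} {k m r : ℕ} :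
      Runs b x (.cons u v) k → Runs f x y m → Runs (.loop b f) y z r →
        Runs (.loop b f) x z (1 + x.size + k + m + r)

/-- Programs are deterministic: output and cost are determined by the input. -/
theorem Runs.unique {P : Prog} {x y : Tree} {k : ℕ} (h : Runs P x y k) :
    ∀ {y' : Tree} {k' : ℕ}, Runs P x y' k' → y' = y ∧ k' = k := by
  induction h with
  | id x => intro y' k' h'; cases h'; exact ⟨rfl, rfl⟩
  | nil x => intro y' k' h'; cases h'; exact ⟨rfl, rfl⟩
  | hd x => intro y' k' h'; cases h'; exact ⟨rfl, rfl⟩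
  | tl x => intro y' k' h'; cases h'; exact ⟨rfl, rfl⟩
  | comp _ _ ihf ihg =>
    intro y' k' h'
    cases h' with
    | comp h1 h2 =>
      obtain ⟨rfl, rfl⟩ := ihf h1
      obtain ⟨rfl, rfl⟩ := ihg h2
      exact ⟨rfl, rfl⟩
  | pair _ _ ihf ihg =>
    intro y' k' h'
    cases h' with
    | pair h1 h2 =>
      obtain ⟨rfl, rfl⟩ := ihf h1
      obtain ⟨rfl, rfl⟩ := ihg h2
      exact ⟨rfl, rfl⟩
  | condTrue _ _ ihb ihf =>
    intro y' k' h'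
    cases h' with
    | condTrue h1 h2 =>
      obtain ⟨-, rfl⟩ := ihb h1
      obtain ⟨rfl, rfl⟩ := ihf h2
      exact ⟨rfl, rfl⟩
    | condFalse h1 h2 => exact absurd (ihb h1).1 (by simp)
  | condFalse _ _ ihb ihg =>
    intro y' k' h'
    cases h' with
    | condTrue h1 h2 => exact absurd (ihb h1).1 (by simp)
    | condFalse h1 h2 =>
      obtain ⟨-, rfl⟩ := ihb h1
      obtain ⟨rfl, rfl⟩ := ihg h2
      exact ⟨rfl, rfl⟩
  | loopStop _ ihb =>
    intro y' k' h'
    cases h' with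
    | loopStop h1 =>
      obtain ⟨-, rfl⟩ := ihb h1
      exact ⟨rfl, rfl⟩
    | loopStep h1 h2 h3 => exact absurd (ihb h1).1 (by simp)
  | loopStep _ _ _ ihb ihf ihl =>
    intro y' k' h'
    cases h' with
    | loopStop h1 => exact absurd (ihb h1).1 (by simp)
    | loopStep h1 h2 h3 =>
      obtain ⟨-, rfl⟩ := ihb h1
      obtain ⟨rfl, rfl⟩ := ihf h2
      obtain ⟨rfl, rfl⟩ := ihl h3
      exact ⟨rfl, rfl⟩

/-- The output of a run is no larger than its cost. -/
theorem Runs.size_le {P : Prog} {x y : Tree} {k : ℕ} (h : Runs P x y k) : y.size ≤ k := by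
  induction h with
  | id x => omega
  | nil x => simp only [Tree.size]; omega
  | hd x => cases x <;> simp only [Tree.hd, Tree.size] <;> omega
  | tl x => cases x <;> simp only [Tree.tl, Tree.size] <;> omega
  | pair _ _ _ _ => simp only [Tree.size]; omega
  | _ => omega

/-- With cost at most `k`, the program `P` on input `x` answers the question whether `Q` holds
("yes" is any output other than `nil`). -/
def Prog.AnswersWithin (P : Prog) (x : Tree) (k : ℕ) (Q : Prop) : Prop :=
  ∃ (y : Tree) (c : ℕ), Runs P x y c ∧ c ≤ k ∧ (y ≠ Tree.nil ↔ Q)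

/-! ## Encoding of the inputs as trees -/

def encList {α : Type} (enc : α → Tree) : List α → Tree
  | [] => .nil
  | a :: as => .cons (enc a) (encList enc as)

def encBool : Bool → Tree
  | false => .nil
  | true => .cons .nil .nil

/-- A natural number is given by the list of its binary digits. -/
def encNat (n : ℕ) : Tree := encList encBool n.bits

def encElem : Elem → Tree
  | .const a => .cons (encNat 0) (encNat a)
  | .opn k => .cons (encNat 1) (encNat k)
  | .clo k => .cons (encNat 2) (encNat k)

def encFact (f : Fact Elem) : Tree := .cons (encNat f.rel) (encList encElem f.args)

def encUnequality (e : Elem × Elem) : Tree := .cons (encElem e.1) (encElem e.2)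

def encCondTable (T : CondTable) : Tree :=
  .cons (encList encFact T.facts) (encList (encList encUnequality) T.cond)

def encTuple {n : ℕ} (t : Fin n → Cons) : Tree := encList encNat (List.ofFn t)

/-- The encoding of the data `((T, φ*), t)`. -/
def encData {n : ℕ} (T : CondTable) (t : Fin n → Cons) : Tree :=
  .cons (encCondTable T) (encTuple t)

def encTerm : Term → Tree
  | .var x => .cons (encNat 0) (encNat x)
  | .const a => .cons (encNat 1) (encNat a)

def encAtom (A : Atom) : Tree := .cons (encNat A.rel) (encList encTerm A.args)

def encFormula : QFFormula → Tree
  | .rel A => .cons (encNat 0) (encAtom A)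
  | .eq s t => .cons (encNat 1) (.cons (encTerm s) (encTerm t))
  | .neg β => .cons (encNat 2) (encFormula β)
  | .and β γ => .cons (encNat 3) (.cons (encFormula β) (encFormula γ))
  | .or β γ => .cons (encNat 4) (.cons (encFormula β) (encFormula γ))

def encQuery (q : UniversalQuery) : Tree := .cons (encNat q.arity) (encFormula q.matrix)

end DataExchange

/-! # Certain answers of universal queries over semi-naive tables

A tuple is not a certain answer if and only if some instance `J` in `Rep(T, φ*)` and some assignment
of the variables that extends the tuple make the matrix of the query false. Such a counterexample
can be found by a tableau, for an arbitrary table with a global condition.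

A branch of the tableau decides which atoms of the query are true. A true atom `A` is matched with a
fact of `T` under some valuation of the open nulls. As a represented instance may use any number of
valuations of the open nulls, each atom can have a valuation of its own, so the open nulls get one
copy for each atom that is assumed to be true. The matches amount to equations between constants,
variables of the query, closed nulls and copies of open nulls. Everything else (the atoms and
equations that are assumed to be false, and the global condition) consists of disjunctions of
conjunctions of unequalities. Since there are infinitely many constants, the most general solution
of the equations, in which different classes have different values, satisfies every unequality that
some solution satisfies. So it suffices to look at the most general solution, which is given by a
triangular substitution (`resolve`): see `Branch.exists_holds` for soundness and `Branch.Holds.step`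
with `Branch.accepts_of_holds` for completeness.

A branch grows by a number of steps that depends on the query alone (`Branch.weight_step`), and in
each step it splits into at most as many branches as there are facts in the table, or two. The
bound on the cost uses no more than this: a round that treats all branches at once is a
polynomial-time function, and a fixed number of rounds, for each query, keeps the whole loop
polynomial in the size of the data (`exists_slicewise_loop`). That the functions involved are
computed by programs in polynomial time is derived from closure properties of the predicate
`PolyTime` on functions between encoded types. All loops over data are instances of
`PolyTime.loop`, which asks for a potential that decreases in every step. -/

open Polynomial

namespace DataExchange

/-! ### Polynomial-time functions between encoded types -/

/-- A type whose elements are given to programs as trees. -/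
class Enc (α : Type) where
  enc : α → Tree

open Enc (enc)

instance : Enc Tree := ⟨id⟩
instance : Enc Bool := ⟨encBool⟩
instance : Enc ℕ := ⟨encNat⟩
instance {α : Type} [Enc α] : Enc (List α) := ⟨encList enc⟩
instance {α β : Type} [Enc α] [Enc β] : Enc (α × β) := ⟨fun a => .cons (enc a.1) (enc a.2)⟩
instance {α β : Type} [Enc α] [Enc β] : Enc (α ⊕ β) :=
  ⟨Sum.elim (fun a => .cons .nil (enc a)) fun b => .cons (.cons .nil .nil) (enc b)⟩

variable {α β γ δ σ : Type} [Enc α] [Enc β] [Enc γ] [Enc δ] [Enc σ]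

@[simp] theorem enc_tree (t : Tree) : enc t = t := rfl
@[simp] theorem enc_true : enc true = .cons .nil .nil := rfl
@[simp] theorem enc_false : enc false = .nil := rfl
@[simp] theorem enc_prod (a : α × β) : enc a = .cons (enc a.1) (enc a.2) := rfl
@[simp] theorem enc_nil : enc ([] : List α) = .nil := rfl
@[simp] theorem enc_cons (a : α) (l : List α) : enc (a :: l) = .cons (enc a) (enc l) := rfl
@[simp] theorem enc_inl (a : α) : enc (Sum.inl a : α ⊕ β) = .cons .nil (enc a) := rfl
@[simp] theorem enc_inr (b : β) :
    enc (Sum.inr b : α ⊕ β) = .cons (.cons .nil .nil) (enc b) := rfl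

attribute [simp] Tree.hd Tree.tl Tree.size

theorem eval_le_eval (p : ℕ[X]) {m n : ℕ} (h : m ≤ n) : p.eval m ≤ p.eval n := by
  induction p using Polynomial.induction_on' with
  | add p q hp hq => simpa using Nat.add_le_add hp hq
  | monomial k a => simpa using Nat.mul_le_mul_left a (Nat.pow_le_pow_left h k)

/-- On input `x` the program `P` returns `y` with cost at most `k`. -/
def RunsIn (P : Prog) (x y : Tree) (k : ℕ) : Prop := ∃ c ≤ k, Runs P x y c

theorem RunsIn.mono {P : Prog} {x y : Tree} {k m : ℕ} (h : RunsIn P x y k) (hkm : k ≤ m) :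
    RunsIn P x y m :=
  let ⟨c, hc, hr⟩ := h; ⟨c, hc.trans hkm, hr⟩

theorem RunsIn.size_le {P : Prog} {x y : Tree} {k : ℕ} (h : RunsIn P x y k) : y.size ≤ k :=
  let ⟨_, hc, hr⟩ := h; hr.size_le.trans hc

theorem RunsIn.comp {P Q : Prog} {x y z : Tree} {k m : ℕ} (h₁ : RunsIn P x y k)
    (h₂ : RunsIn Q y z m) : RunsIn (.comp P Q) x z (1 + k + m) :=
  let ⟨_, hc, hr⟩ := h₁; let ⟨_, hd, hs⟩ := h₂; ⟨_, by omega, .comp hr hs⟩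

theorem RunsIn.pair {P Q : Prog} {x y z : Tree} {k m : ℕ} (h₁ : RunsIn P x y k)
    (h₂ : RunsIn Q x z m) : RunsIn (.pair P Q) x (.cons y z) (1 + x.size + k + m) :=
  let ⟨_, hc, hr⟩ := h₁; let ⟨_, hd, hs⟩ := h₂; ⟨_, by omega, .pair hr hs⟩

theorem RunsIn.cond {B P Q : Prog} {x y : Tree} {b : Bool} {k m : ℕ}
    (hb : RunsIn B x (enc b) k) (ht : b = true → RunsIn P x y m)
    (hf : b = false → RunsIn Q x y m) : RunsIn (.cond B P Q) x y (1 + x.size + k + m) := by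
  obtain ⟨_, hc, hr⟩ := hb
  cases b with
  | true => obtain ⟨_, hd, hs⟩ := ht rfl; exact ⟨_, by omega, .condTrue hr hs⟩
  | false => obtain ⟨_, hd, hs⟩ := hf rfl; exact ⟨_, by omega, .condFalse hr hs⟩

theorem RunsIn.loopStop {B F : Prog} {x : Tree} {k : ℕ} (hb : RunsIn B x .nil k) :
    RunsIn (.loop B F) x x (1 + x.size + k) :=
  let ⟨_, hc, hr⟩ := hb; ⟨_, by omega, .loopStop hr⟩

theorem RunsIn.loopStep {B F : Prog} {x y z : Tree} {k m r : ℕ}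
    (hb : RunsIn B x (enc true) k) (hf : RunsIn F x y m) (hl : RunsIn (.loop B F) y z r) :
    RunsIn (.loop B F) x z (1 + x.size + k + m + r) :=
  let ⟨_, hc, hr⟩ := hb; let ⟨_, hd, hs⟩ := hf; let ⟨_, he, ht⟩ := hl
  ⟨_, by omega, .loopStep hr hs ht⟩

/-- A program computes `f` on encodings, with cost polynomial in the size of the input. -/
@[fun_prop]
def PolyTime (f : α → β) : Prop :=
  ∃ (P : Prog) (p : ℕ[X]), ∀ a, RunsIn P (enc a) (enc (f a)) (p.eval (enc a).size)

namespace PolyTime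

theorem congr {f g : α → β} (hf : PolyTime f) (h : ∀ a, f a = g a) : PolyTime g :=
  (_root_.funext h : f = g) ▸ hf

theorem size_le {f : α → β} (hf : PolyTime f) :
    ∃ p : ℕ[X], ∀ a, (enc (f a)).size ≤ p.eval (enc a).size :=
  let ⟨_, p, h⟩ := hf; ⟨p, fun a => (h a).size_le⟩

/-- It suffices to transform the encodings. -/
theorem of_tree {f : α → β} {g : Tree → Tree} (hg : PolyTime g)
    (h : ∀ a, g (enc a) = enc (f a)) : PolyTime f :=
  let ⟨P, p, hP⟩ := hg; ⟨P, p, fun a => h a ▸ hP (enc a)⟩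

@[fun_prop]
theorem id : PolyTime fun a : α => a :=
  ⟨.id, 1 + X, fun a => ⟨_, by simp, .id _⟩⟩

/-- A function that does not change the encoding. -/
theorem of_enc_eq {f : α → β} (h : ∀ a, enc (f a) = enc a) : PolyTime f :=
  of_tree (g := fun x => x) .id fun a => (h a).symm

@[fun_prop]
theorem comp {f : β → γ} {g : α → β} (hf : PolyTime f) (hg : PolyTime g) :
    PolyTime fun a => f (g a) := by
  obtain ⟨P, p, hP⟩ := hg
  obtain ⟨Q, q, hQ⟩ := hf
  refine ⟨.comp P Q, 1 + p + q.comp p, fun a => ((hP a).comp (hQ _)).mono ?_⟩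
  have := eval_le_eval q (hP a).size_le
  simp only [eval_add, eval_one, eval_comp]; omega

@[fun_prop]
theorem pair {f : α → β} {g : α → γ} (hf : PolyTime f) (hg : PolyTime g) :
    PolyTime fun a => (f a, g a) := by
  obtain ⟨P, p, hP⟩ := hf
  obtain ⟨Q, q, hQ⟩ := hg
  exact ⟨.pair P Q, 1 + X + p + q, fun a => ((hP a).pair (hQ a)).mono (by simp)⟩

@[fun_prop]
theorem treeHd {f : α → Tree} (hf : PolyTime f) : PolyTime fun a => (f a).hd :=
  comp (f := Tree.hd) ⟨.hd, 1 + X, fun a => ⟨_, by simp, .hd _⟩⟩ hf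

@[fun_prop]
theorem treeTl {f : α → Tree} (hf : PolyTime f) : PolyTime fun a => (f a).tl :=
  comp (f := Tree.tl) ⟨.tl, 1 + X, fun a => ⟨_, by simp, .tl _⟩⟩ hf

@[fun_prop]
theorem treeCons {f g : α → Tree} (hf : PolyTime f) (hg : PolyTime g) :
    PolyTime fun a => Tree.cons (f a) (g a) :=
  comp (f := fun p : Tree × Tree => Tree.cons p.1 p.2) (of_enc_eq fun _ => rfl) (pair hf hg)

@[fun_prop]
theorem fst {f : α → β × γ} (hf : PolyTime f) : PolyTime fun a => (f a).1 :=
  comp (f := Prod.fst) (of_tree (g := Tree.hd) (by fun_prop) fun _ => rfl) hf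

@[fun_prop]
theorem snd {f : α → β × γ} (hf : PolyTime f) : PolyTime fun a => (f a).2 :=
  comp (f := Prod.snd) (of_tree (g := Tree.tl) (by fun_prop) fun _ => rfl) hf

@[fun_prop]
theorem toTree {f : α → β} (hf : PolyTime f) : PolyTime fun a => enc (f a) :=
  comp (f := fun b : β => enc b) (of_enc_eq fun _ => rfl) hf

theorem const_tree (t : Tree) : PolyTime fun _ : α => t := by
  induction t with
  | nil => exact ⟨.nil, 1 + X, fun a => ⟨_, by simp, .nil _⟩⟩
  | cons l r hl hr => exact treeCons hl hr

@[fun_prop]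
theorem const (b : β) : PolyTime fun _ : α => b :=
  of_tree (const_tree (enc b)) fun _ => rfl

theorem boolCond {c : α → Bool} {f g : α → β} (hc : PolyTime c) (hf : PolyTime f)
    (hg : PolyTime g) : PolyTime fun a => bif c a then f a else g a := by
  obtain ⟨B, b, hB⟩ := hc
  obtain ⟨P, p, hP⟩ := hf
  obtain ⟨Q, q, hQ⟩ := hg
  refine ⟨.cond B P Q, 1 + X + b + (p + q), fun a => ((hB a).cond (m := (p + q).eval (enc a).size)
    (fun h => ?_) (fun h => ?_)).mono (by simp)⟩
  · simpa only [h, cond_true] using (hP a).mono (by simp)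
  · simpa only [h, cond_false] using (hQ a).mono (by simp)

@[fun_prop]
theorem ite {c : α → Prop} [DecidablePred c] {f g : α → β} (hc : PolyTime fun a => decide (c a))
    (hf : PolyTime f) (hg : PolyTime g) : PolyTime fun a => if c a then f a else g a := by
  simpa [Bool.cond_decide] using boolCond hc hf hg

@[fun_prop]
theorem not {c : α → Bool} (hc : PolyTime c) : PolyTime fun a => !c a := by
  simpa using boolCond hc (const false) (const true)

@[fun_prop]
theorem and {c d : α → Bool} (hc : PolyTime c) (hd : PolyTime d) :
    PolyTime fun a => c a && d a := by
  simpa using boolCond hc hd (const false)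

@[fun_prop]
theorem or {c d : α → Bool} (hc : PolyTime c) (hd : PolyTime d) :
    PolyTime fun a => c a || d a := by
  simpa using boolCond hc (const true) hd

@[fun_prop]
theorem decide_not {c : α → Prop} [DecidablePred c] (hc : PolyTime fun a => decide (c a)) :
    PolyTime fun a => decide (¬ c a) := by
  simpa using not hc

@[fun_prop]
theorem decide_and {c d : α → Prop} [DecidablePred c] [DecidablePred d]
    (hc : PolyTime fun a => decide (c a)) (hd : PolyTime fun a => decide (d a)) :
    PolyTime fun a => decide (c a ∧ d a) := by
  simpa using and hc hd

@[fun_prop]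
theorem cons {f : α → β} {g : α → List β} (hf : PolyTime f) (hg : PolyTime g) :
    PolyTime fun a => f a :: g a :=
  comp (f := fun p : β × List β => p.1 :: p.2) (of_enc_eq fun _ => rfl) (pair hf hg)

@[fun_prop]
theorem inl {f : α → β} (hf : PolyTime f) : PolyTime fun a => (Sum.inl (f a) : β ⊕ γ) :=
  of_tree (g := fun x => .cons .nil x) (f := fun b : β => (Sum.inl b : β ⊕ γ)) (by fun_prop)
    (fun _ => rfl) |>.comp hf

@[fun_prop]
theorem inr {f : α → γ} (hf : PolyTime f) : PolyTime fun a => (Sum.inr (f a) : β ⊕ γ) :=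
  of_tree (g := fun x => .cons (.cons .nil .nil) x) (f := fun b : γ => (Sum.inr b : β ⊕ γ))
    (by fun_prop) (fun _ => rfl) |>.comp hf

/-- Whether a tree is not a leaf. -/
def isNode : Tree → Bool
  | .nil => false
  | .cons _ _ => true

/-- A program may branch on whether a tree that it computes is a leaf. The two parts of the program
have to be correct only in their own cases. -/
theorem branch {s : α → Tree} {P Q : Prog} {p q : ℕ[X]} {f : α → β} (hs : PolyTime s)
    (hP : ∀ a, isNode (s a) = true → RunsIn P (enc a) (enc (f a)) (p.eval (enc a).size))
    (hQ : ∀ a, isNode (s a) = false → RunsIn Q (enc a) (enc (f a)) (q.eval (enc a).size)) :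
    PolyTime f := by
  obtain ⟨B, b, hB⟩ := hs
  refine ⟨.cond B P Q, 1 + X + b + (p + q), fun a => ?_⟩
  obtain ⟨c, hc, hr⟩ := hB a
  cases hsa : s a with
  | nil =>
    rw [hsa] at hr
    obtain ⟨d, hd, ht⟩ := hQ a (by rw [hsa]; rfl)
    exact ⟨_, by simp; omega, .condFalse hr ht⟩
  | cons l r =>
    rw [hsa] at hr
    obtain ⟨d, hd, ht⟩ := hP a (by rw [hsa]; rfl)
    exact ⟨_, by simp; omega, .condTrue hr ht⟩

@[fun_prop]
theorem isNode_comp {s : α → Tree} (hs : PolyTime s) : PolyTime fun a => isNode (s a) := by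
  obtain ⟨P, p, hP⟩ := const (α := α) true
  obtain ⟨Q, q, hQ⟩ := const (α := α) false
  exact branch (P := P) (Q := Q) hs (fun a h => h ▸ hP a) (fun a h => h ▸ hQ a)

/-- Case distinction on a sum type. -/
theorem sumCases {f : α → β ⊕ γ} {g : α × β → δ} {h : α × γ → δ} (hf : PolyTime f)
    (hg : PolyTime g) (hh : PolyTime h) :
    PolyTime fun a => Sum.elim (fun b => g (a, b)) (fun c => h (a, c)) (f a) := by
  suffices H : PolyTime fun p : α × (β ⊕ γ) =>
      Sum.elim (fun b => g (p.1, b)) (fun c => h (p.1, c)) p.2 from H.comp (pair id hf)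
  -- both branches run on the input without its tag
  obtain ⟨P, p, hP⟩ := hg
  obtain ⟨Q, q, hQ⟩ := hh
  obtain ⟨U, u, hU⟩ : PolyTime fun t : Tree => Tree.cons t.hd t.tl.tl := by fun_prop
  have hs : PolyTime fun p : α × (β ⊕ γ) => (enc p).tl.hd := by fun_prop
  refine branch (P := .comp U Q) (Q := .comp U P) (p := 1 + u + q) (q := 1 + u + p) hs ?_ ?_
  · rintro ⟨a, b | c⟩ hb
    · simp [isNode] at hb
    · refine ((hU _).comp (hQ (a, c))).mono ?_
      have : (enc (a, c)).size ≤ (enc (a, (Sum.inr c : β ⊕ γ))).size := by simp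
      have := eval_le_eval q this
      simp only [eval_add, eval_one]; exact Nat.add_le_add_left this _
  · rintro ⟨a, b | c⟩ hb
    · refine ((hU _).comp (hP (a, b))).mono ?_
      have : (enc (a, b)).size ≤ (enc (a, (Sum.inl b : β ⊕ γ))).size := by simp
      have := eval_le_eval p this
      simp only [eval_add, eval_one]; exact Nat.add_le_add_left this _
    · simp [isNode] at hb

/-- The first entry and the rest of a list, if it is not empty. -/
def uncons {α : Type} : List α → Unit ⊕ α × List α
  | [] => .inl ()
  | a :: l => .inr (a, l)

instance : Enc Unit := ⟨fun _ => .nil⟩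

theorem uncons_comp {f : α → List β} (hf : PolyTime f) : PolyTime fun a => uncons (f a) := by
  refine comp (f := uncons) (of_tree (g := fun x => bif isNode x then .cons (.cons .nil .nil) x
    else .cons .nil .nil) (boolCond ?_ ?_ ?_) ?_) hf
  · fun_prop
  · fun_prop
  · fun_prop
  · rintro (_ | ⟨a, l⟩) <;> rfl

/-- Case distinction on a list, as a function. -/
def listElim {α β : Type} (l : List α) (b : β) (f : α → List α → β) : β :=
  match l with
  | [] => b
  | a :: l => f a l

@[simp] theorem listElim_nil {α β : Type} (b : β) (f : α → List α → β) :
    listElim [] b f = b := rfl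
@[simp] theorem listElim_cons {α β : Type} (a : α) (l : List α) (b : β) (f : α → List α → β) :
    listElim (a :: l) b f = f a l := rfl

theorem listCases {f : α → List β} {g : α → γ} {h : α → β → List β → γ} (hf : PolyTime f)
    (hg : PolyTime g) (hh : PolyTime fun p : α × β × List β => h p.1 p.2.1 p.2.2) :
    PolyTime fun a => listElim (f a) (g a) (h a) := by
  have := sumCases (g := fun p : α × Unit => g p.1) (uncons_comp hf) (hg.comp (fst id)) hh
  exact this.congr fun a => by cases f a <;> rfl

@[fun_prop]
theorem tail {f : α → List β} (hf : PolyTime f) : PolyTime fun a => (f a).tail :=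
  of_tree (g := Tree.tl) (f := List.tail) (by fun_prop) (by rintro (_ | _) <;> rfl) |>.comp hf

@[fun_prop]
theorem isEmpty {f : α → List β} (hf : PolyTime f) : PolyTime fun a => (f a).isEmpty := by
  have : PolyTime fun a => !isNode (enc (f a)) := by fun_prop
  exact this.congr fun a => by cases f a <;> rfl

/-! ### Loops -/

/-- A loop whose first `N` states have size at most `B`, and which stops among them, has cost
linear in `N` and polynomial in `B`. -/
theorem exists_loop {step : σ → σ} {test : σ → Bool} (hs : PolyTime step) (ht : PolyTime test) :
    ∃ (P : Prog) (p : ℕ[X]), ∀ (N B : ℕ) (s : σ), (∀ i ≤ N, (enc (step^[i] s)).size ≤ B) →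
      test (step^[N] s) = false → ∃ i ≤ N, test (step^[i] s) = false ∧
        RunsIn P (enc s) (enc (step^[i] s)) ((N + 1) * p.eval B) := by
  obtain ⟨F, f, hF⟩ := hs
  obtain ⟨T, t, hT⟩ := ht
  refine ⟨.loop T F, 1 + X + t + f, fun N => ?_⟩
  induction N with
  | zero =>
    intro B s hB hN
    refine ⟨0, le_rfl, hN, ?_⟩
    have hB := hB 0 le_rfl
    have h := hT s
    rw [show test s = false from hN] at h
    refine h.loopStop.mono ?_
    have := eval_le_eval t hB
    simp only [Function.iterate_zero, id_eq] at hB this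
    simp; omega
  | succ N ih =>
    intro B s hB hN
    have hB0 := hB 0 (by omega)
    simp only [Function.iterate_zero, id_eq] at hB0
    have h1 := eval_le_eval t hB0
    have h2 := eval_le_eval f hB0
    have h := hT s
    cases hts : test s with
    | false =>
      refine ⟨0, by omega, hts, ?_⟩
      rw [hts] at h
      refine h.loopStop.mono ?_
      simp only [eval_add, eval_one, eval_X]
      nlinarith
    | true =>
      obtain ⟨i, hi, hti, hr⟩ := ih B (step s) (fun i hi => hB (i + 1) (by omega)) hN
      refine ⟨i + 1, by omega, hti, ?_⟩
      rw [hts] at h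
      refine (h.loopStep (hF s) hr).mono ?_
      simp only [eval_add, eval_one, eval_X]
      nlinarith

/-- A loop with a potential `Φ` that bounds the size of the state, decreases in every step and is
initially polynomial in the size of the state. The function `R` is the value of the loop. -/
theorem loop {step : σ → σ} {test : σ → Bool} {R : σ → σ} (hs : PolyTime step)
    (ht : PolyTime test) (Φ : σ → ℕ) (p : ℕ[X]) (hdone : ∀ s, test s = false → R s = s)
    (hstep : ∀ s, test s = true → R (step s) = R s ∧ Φ (step s) < Φ s)
    (hsize : ∀ s, (enc s).size ≤ Φ s) (hp : ∀ s, Φ s ≤ p.eval (enc s).size) : PolyTime R := by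
  obtain ⟨F, f, hF⟩ := hs
  obtain ⟨T, t, hT⟩ := ht
  refine ⟨.loop T F, (p + 1) * (1 + p + t.comp p + f.comp p), fun s => ?_⟩
  have key : ∀ B s, Φ s ≤ B → RunsIn (.loop T F) (enc s) (enc (R s))
      ((Φ s + 1) * (1 + B + t.eval B + f.eval B)) := by
    intro B s
    induction hn : Φ s using Nat.strong_induction_on generalizing s with
    | _ n ih =>
      intro hB
      have hB0 := (hsize s).trans (hn ▸ hB)
      have h1 := eval_le_eval t hB0
      have h2 := eval_le_eval f hB0
      have h := hT s
      cases hts : test s with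
      | false =>
        rw [hts] at h
        rw [hdone s hts]
        refine h.loopStop.mono ?_
        nlinarith
      | true =>
        rw [hts] at h
        obtain ⟨hR, hlt⟩ := hstep s hts
        have := ih _ (hn ▸ hlt) (step s) rfl (by omega)
        rw [hR] at this
        refine (h.loopStep (hF s) this).mono ?_
        have h3 : Φ (step s) + 1 ≤ n := by omega
        have := Nat.mul_le_mul_right (1 + B + t.eval B + f.eval B) h3
        rw [Nat.succ_mul n]
        omega
  refine (key _ s (hp s)).mono ?_
  simp only [eval_add, eval_mul, eval_one, eval_comp]
  exact Nat.mul_le_mul_right _ (Nat.add_le_add_right (hp s) 1)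

end PolyTime

/-! ### Lists, equality and numbers in polynomial time -/

namespace PolyTime

/-- The list that `l.map g` pushes entry by entry onto another list. Reversal, concatenation and
`List.map` are instances. -/
theorem revMapAppend {f : α → List β} {g : α → β → γ} {h : α → List γ} (hf : PolyTime f)
    (hg : PolyTime fun p : α × β => g p.1 p.2) (hh : PolyTime h) :
    PolyTime fun a => ((f a).map (g a)).reverse ++ h a := by
  obtain ⟨p, hp⟩ := hg.size_le
  have key : PolyTime fun s : α × List β × List γ =>
      (s.1, ([] : List β), (s.2.1.map (g s.1)).reverse ++ s.2.2) := by
    refine loop (test := fun s => !s.2.1.isEmpty)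
      (step := fun s => listElim s.2.1 s fun b l => (s.1, l, g s.1 b :: s.2.2))
      ?_ (by fun_prop) (fun s => (enc s).size + (s.2.1.map fun b => p.eval (enc (s.1, b)).size + 1).sum)
      (X + X * (p + 1)) ?_ ?_ (fun s => Nat.le_add_right _ _) ?_
    · have : PolyTime fun q : (α × List β × List γ) × β × List β => g q.1.1 q.2.1 :=
        hg.comp (g := fun q : (α × List β × List γ) × β × List β => (q.1.1, q.2.1)) (by fun_prop)
      exact listCases (by fun_prop) (by fun_prop) (by fun_prop)
    · rintro ⟨a, _ | ⟨b, l⟩, acc⟩ <;> simp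
    · rintro ⟨a, _ | ⟨b, l⟩, acc⟩ <;> simp
      have := hp (a, b)
      simp only [enc_prod, Tree.size] at this
      omega
    · rintro ⟨a, l, acc⟩
      simp only [eval_add, eval_mul, eval_X, eval_one]
      refine Nat.add_le_add_left ?_ _
      have hl : (enc l).size ≤ (enc (a, l, acc)).size := by simp; omega
      have ha : 1 + (enc a).size + (enc l).size ≤ (enc (a, l, acc)).size := by simp; omega
      refine le_trans ?_ (Nat.mul_le_mul_right _ hl)
      generalize (enc (a, l, acc)).size = n at ha
      clear hl
      induction l with
      | nil => simp
      | cons b l ih =>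
        have hb : (enc (a, b)).size ≤ n := by
          simp only [enc_cons, enc_prod, Tree.size] at *; omega
        have hb := eval_le_eval p hb
        have := ih (by simp only [enc_cons, Tree.size] at *; omega)
        simp only [List.map_cons, List.sum_cons, enc_cons, Tree.size] at *
        nlinarith [(enc b).size.zero_le]
  exact key.comp (g := fun a => (a, f a, h a)) (by fun_prop) |>.snd |>.snd

@[fun_prop]
theorem reverse {f : α → List β} (hf : PolyTime f) : PolyTime fun a => (f a).reverse :=
  (revMapAppend hf (g := fun _ b => b) (by fun_prop) (const [])).congr (by simp)

@[fun_prop]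
theorem append {f g : α → List β} (hf : PolyTime f) (hg : PolyTime g) :
    PolyTime fun a => f a ++ g a :=
  (revMapAppend (reverse hf) (g := fun _ b => b) (by fun_prop) hg).congr (by simp)

theorem map {f : α → List β} {g : α → β → γ} (hf : PolyTime f)
    (hg : PolyTime fun p : α × β => g p.1 p.2) : PolyTime fun a => (f a).map (g a) :=
  (reverse (revMapAppend hf hg (const []))).congr (by simp)

theorem any {f : α → List β} {g : α → β → Bool} (hf : PolyTime f)
    (hg : PolyTime fun p : α × β => g p.1 p.2) : PolyTime fun a => (f a).any (g a) := by
  have key : PolyTime fun s : α × List β => (s.1, s.2.dropWhile fun b => !g s.1 b) := by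
    refine loop (step := fun s => (s.1, s.2.tail))
      (test := fun s => listElim s.2 false fun b _ => !g s.1 b)
      (by fun_prop) (listCases (by fun_prop) (by fun_prop) ?_)
      (fun s => (enc s).size) X ?_ ?_ (fun s => le_rfl) (by simp)
    · have : PolyTime fun q : (α × List β) × β × List β => g q.1.1 q.2.1 :=
        hg.comp (g := fun q : (α × List β) × β × List β => (q.1.1, q.2.1)) (by fun_prop)
      fun_prop
    · rintro ⟨a, _ | ⟨b, l⟩⟩ <;> simp +contextual
    · rintro ⟨a, _ | ⟨b, l⟩⟩ <;> simp +contextual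
  have : PolyTime fun a => !((f a).dropWhile fun b => !g a b).isEmpty := by
    have := snd (key.comp (g := fun a => (a, f a)) (by fun_prop))
    exact not (isEmpty this)
  refine this.congr fun a => ?_
  induction f a with
  | nil => rfl
  | cons b l ih => cases hb : g a b <;> simp_all

theorem all {f : α → List β} {g : α → β → Bool} (hf : PolyTime f)
    (hg : PolyTime fun p : α × β => g p.1 p.2) : PolyTime fun a => (f a).all (g a) :=
  (not (any hf (g := fun a b => !g a b) (by fun_prop))).congr fun a => by
    simp [List.all_eq_not_any_not]

theorem flatten {f : α → List (List β)} (hf : PolyTime f) : PolyTime fun a => (f a).flatten := by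
  have key : PolyTime fun s : List (List β) × List β =>
      (([] : List (List β)), s.1.flatten.reverse ++ s.2) := by
    refine loop (test := fun s => !s.1.isEmpty)
      (step := fun s => listElim s.1 s fun l r =>
        listElim l (r, s.2) fun b l => (l :: r, b :: s.2))
      ?_ (by fun_prop)
      (fun s => (enc s).size + (enc s.1).size) (X + X) ?_ ?_
      (fun s => Nat.le_add_right _ _) ?_
    · refine listCases (by fun_prop) (by fun_prop) ?_
      exact listCases (by fun_prop) (by fun_prop) (by fun_prop)
    · rintro ⟨_ | ⟨_ | ⟨b, l⟩, r⟩, acc⟩ <;> simp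
    · rintro ⟨_ | ⟨_ | ⟨b, l⟩, r⟩, acc⟩ <;> simp <;> omega
    · rintro ⟨r, acc⟩
      simp
      omega
  have := key.comp (g := fun a => (f a, [])) (by fun_prop)
  refine (reverse (snd this)).congr ?_
  simp

theorem flatMap {f : α → List β} {g : α → β → List γ} (hf : PolyTime f)
    (hg : PolyTime fun p : α × β => g p.1 p.2) : PolyTime fun a => (f a).flatMap (g a) :=
  (flatten (map hf hg)).congr fun a => by rw [List.flatMap_def]

/-- Trees are compared by a loop over a list of pairs of trees that remain to be compared. -/
theorem treeEq [DecidableEq Tree] : PolyTime fun p : Tree × Tree => decide (p.1 = p.2) := by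
  have key : PolyTime fun s : List (Tree × Tree) × Bool =>
      (([] : List (Tree × Tree)), s.2 && s.1.all fun p => decide (p.1 = p.2)) := by
    refine loop (test := fun s => !s.1.isEmpty)
      (step := fun s => listElim s.1 s fun p l => bif isNode p.1 && isNode p.2 then
            ((p.1.hd, p.2.hd) :: (p.1.tl, p.2.tl) :: l, s.2)
          else bif isNode p.1 || isNode p.2 then (l, false) else (l, s.2))
      ?_ (by fun_prop)
      (fun s => (enc s).size + (s.1.map fun p => p.1.size + p.2.size).sum) (X + X) ?_ ?_
      (fun s => Nat.le_add_right _ _) ?_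
    · refine listCases (by fun_prop) (by fun_prop) ?_
      refine boolCond (by fun_prop) (by fun_prop) ?_
      exact boolCond (by fun_prop) (by fun_prop) (by fun_prop)
    · rintro ⟨_ | ⟨⟨_ | ⟨x, y⟩, _ | ⟨z, w⟩⟩, l⟩, _ | _⟩ <;> simp
    · rintro ⟨_ | ⟨⟨_ | ⟨x, y⟩, _ | ⟨z, w⟩⟩, l⟩, _ | _⟩ <;>
        simp [isNode, Bool.and_assoc] <;> omega
    · rintro ⟨l, b⟩
      simp only [eval_add, eval_X]
      refine Nat.add_le_add_left ?_ _
      have : (l.map fun p => p.1.size + p.2.size).sum ≤ (enc l).size := by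
        induction l with
        | nil => simp
        | cons p l ih =>
          simp only [List.map_cons, List.sum_cons, enc_cons, enc_prod, enc_tree, Tree.size]
          omega
      simp only [enc_prod, Tree.size]
      omega
  have := key.comp (g := fun p : Tree × Tree => ([p], true)) (by fun_prop)
  exact (snd this).congr (by simp)

end PolyTime

/-- Different elements have different encodings. -/
class InjEnc (α : Type) [Enc α] : Prop where
  inj : Function.Injective (enc : α → Tree)

instance : InjEnc Bool := ⟨by rintro (_ | _) (_ | _) h <;> simp_all⟩

instance [InjEnc α] : InjEnc (List α) := ⟨fun l => by
  induction l with
  | nil => rintro (_ | _) h <;> simp_all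
  | cons a l ih =>
    rintro (_ | ⟨b, m⟩) h
    · simp at h
    · simp only [enc_cons, Tree.cons.injEq] at h
      rw [InjEnc.inj h.1, ih h.2]⟩

instance [InjEnc α] [InjEnc β] : InjEnc (α × β) := ⟨by
  rintro ⟨a, b⟩ ⟨c, d⟩ h
  simp only [enc_prod, Tree.cons.injEq] at h
  rw [InjEnc.inj h.1, InjEnc.inj h.2]⟩

theorem bits_injective : Function.Injective Nat.bits := fun m n h => by
  have hm := Nat.digits_two_eq_bits m
  rw [h, ← Nat.digits_two_eq_bits n] at hm
  exact Nat.digits.injective 2 hm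

theorem enc_nat (n : ℕ) : enc n = enc n.bits := rfl

instance : InjEnc ℕ := ⟨fun _ _ h => bits_injective (InjEnc.inj (α := List Bool) h)⟩

@[simp] theorem encNat_inj {m n : ℕ} : encNat m = encNat n ↔ m = n :=
  (InjEnc.inj (α := ℕ)).eq_iff

/-- Add one to a number that is given by the list of its binary digits, the lowest one first. -/
def incBits : List Bool → List Bool
  | [] => [true]
  | false :: l => true :: l
  | true :: l => false :: incBits l

theorem incBits_bits (n : ℕ) : incBits n.bits = (n + 1).bits := by
  induction n using Nat.binaryRec' with
  | zero => simp [incBits]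
  | bit b n h ih =>
    rw [Nat.bits_append_bit _ _ h]
    cases b with
    | false =>
      rw [show Nat.bit false n + 1 = 2 * n + 1 by simp [Nat.bit_val], Nat.bit1_bits]; rfl
    | true =>
      rw [show Nat.bit true n + 1 = 2 * (n + 1) by simp [Nat.bit_val]; ring,
        Nat.bit0_bits _ (by omega), ← ih]; rfl

/-- Replace the leading digits `true` of a number by digits `false`, which are moved to the second
list. -/
def carry : List Bool → List Bool → List Bool × List Bool
  | true :: l, acc => carry l (false :: acc)
  | [], acc => ([], acc)
  | false :: l, acc => (false :: l, acc)

theorem carry_eq (l acc : List Bool) :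
    (carry l acc).2.reverse ++ true :: (carry l acc).1.tail = acc.reverse ++ incBits l := by
  induction l generalizing acc with
  | nil => simp [carry, incBits]
  | cons b l ih => cases b <;> simp [carry, incBits, ih]

namespace PolyTime

@[fun_prop]
theorem decide_eq [DecidableEq β] [InjEnc β] {f g : α → β} (hf : PolyTime f) (hg : PolyTime g) :
    PolyTime fun a => decide (f a = g a) := by
  classical
  have := treeEq.comp (g := fun a => (enc (f a), enc (g a))) (by fun_prop)
  exact this.congr fun a => by simp [InjEnc.inj.eq_iff]

@[fun_prop]
theorem succ {f : α → ℕ} (hf : PolyTime f) : PolyTime fun a => f a + 1 := by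
  have key : PolyTime fun s : List Bool × List Bool => carry s.1 s.2 := by
    refine loop (step := fun s => (s.1.tail, false :: s.2))
      (test := fun s => listElim s.1 false fun b _ => b)
      (by fun_prop) ?_
      (fun s => (enc s).size) X ?_ ?_ (fun s => le_rfl) (by simp)
    · exact listCases (by fun_prop) (by fun_prop) (by fun_prop)
    · rintro ⟨_ | ⟨_ | _, l⟩, acc⟩ <;> simp [carry]
    · rintro ⟨_ | ⟨_ | _, l⟩, acc⟩ <;> simp [carry]
      omega
  have h := key.comp (g := fun l : List Bool => (l, [])) (by fun_prop)
  obtain ⟨P, p, hP⟩ : PolyTime incBits :=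
    PolyTime.congr (f := fun l => (carry l []).2.reverse ++ true :: (carry l []).1.tail)
      (by fun_prop) fun l => by simp [carry_eq]
  refine comp (f := fun n : ℕ => n + 1) ⟨P, p, fun n => ?_⟩ hf
  rw [enc_nat (n + 1), ← incBits_bits]
  exact hP n.bits

end PolyTime

/-! ### Tables and queries as inputs -/

instance : Enc Term := ⟨encTerm⟩
instance : Enc Atom := ⟨encAtom⟩
instance : Enc Elem := ⟨encElem⟩
instance : Enc (Fact Elem) := ⟨encFact⟩
instance : Enc CondTable := ⟨encCondTable⟩
instance : Enc QFFormula := ⟨encFormula⟩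
instance : Enc UniversalQuery := ⟨encQuery⟩

theorem enc_atom (A : Atom) : enc A = enc (A.rel, A.args) := rfl

instance : InjEnc Term := ⟨by
  rintro (x | a) (y | b) h <;> simp_all [enc, encTerm]⟩

instance : InjEnc Atom := ⟨fun A B h => by
  rw [enc_atom, enc_atom] at h
  cases A; cases B
  simpa using InjEnc.inj h⟩

/-- The case distinction on formulas; the two binary connectives are told apart by a boolean, which
is `true` for the conjunction. -/
def QFFormula.view : QFFormula → Atom ⊕ (Term × Term) ⊕ QFFormula ⊕ (Bool × QFFormula × QFFormula)
  | .rel A => .inl A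
  | .eq s t => .inr (.inl (s, t))
  | .neg β => .inr (.inr (.inl β))
  | .and β γ => .inr (.inr (.inr (true, β, γ)))
  | .or β γ => .inr (.inr (.inr (false, β, γ)))

instance : InjEnc Tree := ⟨fun _ _ h => h⟩

/-- Programs are given explicitly, so a classical instance serves for stating what they compute. -/
noncomputable instance : DecidableEq Tree := Classical.decEq _

namespace PolyTime

@[fun_prop]
theorem fact_rel {f : α → Fact Elem} (hf : PolyTime f) : PolyTime fun a => (f a).rel :=
  of_tree (g := Tree.hd) (f := fun g : Fact Elem => g.rel) (by fun_prop) (fun _ => rfl) |>.comp hf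

@[fun_prop]
theorem fact_args {f : α → Fact Elem} (hf : PolyTime f) : PolyTime fun a => (f a).args :=
  of_tree (g := Tree.tl) (f := fun g : Fact Elem => g.args) (by fun_prop) (fun _ => rfl) |>.comp hf

@[fun_prop]
theorem atom_rel {f : α → Atom} (hf : PolyTime f) : PolyTime fun a => (f a).rel :=
  of_tree (g := Tree.hd) (f := fun A : Atom => A.rel) (by fun_prop) (fun _ => rfl) |>.comp hf

@[fun_prop]
theorem atom_args {f : α → Atom} (hf : PolyTime f) : PolyTime fun a => (f a).args :=
  of_tree (g := Tree.tl) (f := fun A : Atom => A.args) (by fun_prop) (fun _ => rfl) |>.comp hf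

@[fun_prop]
theorem table_facts {f : α → CondTable} (hf : PolyTime f) : PolyTime fun a => (f a).facts :=
  of_tree (g := Tree.hd) (f := fun T : CondTable => T.facts) (by fun_prop) (fun _ => rfl) |>.comp hf

@[fun_prop]
theorem table_cond {f : α → CondTable} (hf : PolyTime f) : PolyTime fun a => (f a).cond :=
  of_tree (g := Tree.tl) (f := fun T : CondTable => T.cond) (by fun_prop) (fun _ => rfl) |>.comp hf

@[fun_prop]
theorem query_matrix {f : α → UniversalQuery} (hf : PolyTime f) : PolyTime fun a => (f a).matrix :=
  of_tree (g := Tree.tl) (f := fun q : UniversalQuery => q.matrix) (by fun_prop) (fun _ => rfl)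
    |>.comp hf

theorem formula_view {f : α → QFFormula} (hf : PolyTime f) : PolyTime fun a => (f a).view := by
  refine comp (f := QFFormula.view) (of_tree (g := fun x =>
    if x.hd = encNat 0 then .cons .nil x.tl
    else .cons (.cons .nil .nil) (
      if x.hd = encNat 1 then .cons .nil x.tl
      else .cons (.cons .nil .nil) (
        if x.hd = encNat 2 then .cons .nil x.tl
        else .cons (.cons .nil .nil) (
          .cons (if x.hd = encNat 3 then .cons .nil .nil else .nil) x.tl)))) (by fun_prop) ?_) hf
  rintro (A | ⟨s, t⟩ | β | ⟨β, γ⟩ | ⟨β, γ⟩) <;> simp [QFFormula.view, enc, encFormula, encBool]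

end PolyTime

/-! ### The tableau -/

/-- The unknowns and constants of a constraint system: the constants, the variables of the query,
the closed nulls of the table, and copies of the open nulls. The copies belong to valuations of the
open nulls, and there is one valuation for each atom of the query, which provides the fact that the
atom is matched with. -/
inductive Node where
  | const (a : Cons)
  | var (x : ℕ)
  | clo (k : ℕ)
  | opn (A : Atom) (k : ℕ)
  deriving DecidableEq

namespace Node

def isConst : Node → Bool
  | .const _ => true
  | _ => false

def ofTerm : Term → Node
  | .var x => .var x
  | .const a => .const a

/-- The element of the table in the copy for the atom `A`. -/
def ofElem (A : Atom) : Elem → Node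
  | .const a => .const a
  | .opn k => .opn A k
  | .clo k => .clo k

/-- Constants and variables are encoded like terms, and closed nulls like elements of a table. -/
instance : Enc Node := ⟨fun
  | .const a => encTerm (.const a)
  | .var x => encTerm (.var x)
  | .clo k => encElem (.clo k)
  | .opn A k => .cons (encNat 3) (.cons (encAtom A) (encNat k))⟩

instance : InjEnc Node := ⟨by
  have hA : ∀ A B : Atom, encAtom A = encAtom B ↔ A = B := fun _ _ =>
    (InjEnc.inj (α := Atom)).eq_iff
  rintro (a | x | k | ⟨A, k⟩) (b | y | l | ⟨B, l⟩) h <;> simp_all [enc, encTerm, encElem]⟩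

end Node

/-- The value of a node under a triangular substitution, whose newest binding comes first. -/
def resolve (s : List (Node × Node)) (x : Node) : Node :=
  s.foldr (fun e y => if y = e.1 then e.2 else y) x

/-- What remains to be satisfied: that a formula has the given truth value, that two nodes have the
same value, that the variables from `i` on have the values in a list, and that a fact of the table,
in the copy for the atom `A`, has the same entries as an atom. -/
inductive Obligation where
  | formula (pol : Bool) (φ : QFFormula)
  | eqn (x y : Node)
  | bind (i : ℕ) (ts : List Cons)
  | unify (A : Atom) (ss : List Term) (es : List Elem)

/-- The case distinction on obligations, which also serves as their encoding. -/
def Obligation.view : Obligation →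
    (Bool × QFFormula) ⊕ (Node × Node) ⊕ (ℕ × List ℕ) ⊕ (Atom × List Term × List Elem)
  | .formula pol φ => .inl (pol, φ)
  | .eqn x y => .inr (.inl (x, y))
  | .bind i ts => .inr (.inr (.inl (i, ts)))
  | .unify A ss es => .inr (.inr (.inr (A, ss, es)))

instance : Enc Obligation := ⟨fun o => enc o.view⟩

/-- A branch of the tableau: the obligations that remain, the substitution that solves the
equations met so far, the atoms assumed to be true, the atoms assumed to be false, and the
equations assumed to be false. -/
structure Branch where
  todo : List Obligation
  sub : List (Node × Node)
  pos : List Atom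
  negRel : List Atom
  negEq : List (Term × Term)

instance : Enc Branch := ⟨fun b => enc (b.todo, b.sub, b.pos, b.negRel, b.negEq)⟩

namespace Branch

/-- Solve an equation. The list of the resulting branches is empty if there is no solution. -/
def addEqn (b : Branch) (x y : Node) : List Branch :=
  if (resolve b.sub x).isConst = false then
    [{ b with sub := (resolve b.sub x, resolve b.sub y) :: b.sub }]
  else if (resolve b.sub y).isConst = false then
    [{ b with sub := (resolve b.sub y, resolve b.sub x) :: b.sub }]
  else if resolve b.sub x = resolve b.sub y then [b] else []

/-- Assume that an atom is true, by way of some fact of the table, or that it is false. -/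
def addAtom (T : CondTable) (b : Branch) (pol : Bool) (A : Atom) : List Branch :=
  if pol = true then T.facts.flatMap fun f =>
    if f.rel = A.rel then
      [{ b with todo := .unify A A.args f.args :: b.todo, pos := A :: b.pos }] else []
  else [{ b with negRel := A :: b.negRel }]

/-- Assume that an equation between terms is true or that it is false. -/
def addTermEq (b : Branch) (pol : Bool) (s t : Term) : List Branch :=
  if pol = true then [{ b with todo := .eqn (.ofTerm s) (.ofTerm t) :: b.todo }]
  else [{ b with negEq := (s, t) :: b.negEq }]

/-- The two formulas both have the truth value `pol`, or one of them has, according to `both`. -/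
def addPair (b : Branch) (both pol : Bool) (β γ : QFFormula) : List Branch :=
  if both = true then [{ b with todo := .formula pol β :: .formula pol γ :: b.todo }]
  else [{ b with todo := .formula pol β :: b.todo }, { b with todo := .formula pol γ :: b.todo }]

def addFormula (T : CondTable) (b : Branch) (pol : Bool) : QFFormula → List Branch
  | .rel A => b.addAtom T pol A
  | .eq s t => b.addTermEq pol s t
  | .neg β => [{ b with todo := .formula (!pol) β :: b.todo }]
  | .and β γ => b.addPair pol pol β γ
  | .or β γ => b.addPair (!pol) pol β γ

/-- Give the variables from `i` on the values in a list. -/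
def addBind (b : Branch) (i : ℕ) : List Cons → List Branch
  | [] => [b]
  | a :: ts => [{ b with todo := .eqn (.var i) (.const a) :: .bind (i + 1) ts :: b.todo }]

/-- Equate the entries of an atom with those of a fact, in the copy for `A`. The list of the
resulting branches is empty if the lengths differ. -/
def addUnify (b : Branch) (A : Atom) : List Term → List Elem → List Branch
  | [], [] => [b]
  | s :: ss, e :: es =>
    [{ b with todo := .eqn (.ofTerm s) (.ofElem A e) :: .unify A ss es :: b.todo }]
  | _, _ => []

/-- The branches that arise from an obligation. -/
def add (T : CondTable) (b : Branch) : Obligation → List Branch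
  | .formula pol φ => b.addFormula T pol φ
  | .eqn x y => b.addEqn x y
  | .bind i ts => b.addBind i ts
  | .unify A ss es => b.addUnify A ss es

/-- Replace a branch by the branches that arise from its first obligation. -/
def step (T : CondTable) (b : Branch) : List Branch :=
  match b.todo with
  | [] => [b]
  | o :: os => { b with todo := os }.add T o

/-- The atoms whose copies of the open nulls are in use. An arbitrary atom is added, since there has
to be at least one valuation of the open nulls. -/
def copies (b : Branch) : List Atom := ⟨0, []⟩ :: b.pos

/-- The most general solution of the equations satisfies the global condition and the assumptions
about what is false. -/
def accepts (T : CondTable) (b : Branch) : Bool :=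
  (T.cond.all fun d => d.any fun e => b.copies.all fun A => b.copies.all fun B =>
    decide (¬ resolve b.sub (.ofElem A e.1) = resolve b.sub (.ofElem B e.2))) &&
  ((b.negRel.all fun N => T.facts.all fun f => b.copies.all fun A =>
    decide (¬ (N.rel = f.rel ∧ (N.args.map fun s => resolve b.sub (.ofTerm s)) =
      f.args.map fun e => resolve b.sub (.ofElem A e)))) &&
  b.negEq.all fun e => decide (¬ resolve b.sub (.ofTerm e.1) = resolve b.sub (.ofTerm e.2)))

end Branch

/-- A single branch, which says that the query is false for the tuple. -/
def initial (x : UniversalQuery × CondTable × List Cons) : CondTable × List Branch :=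
  (x.2.1, [⟨[.bind 0 x.2.2, .formula false x.1.matrix], [], [], [], []⟩])

/-- One round: every branch is expanded. -/
def tableauStep (s : CondTable × List Branch) : CondTable × List Branch :=
  (s.1, s.2.flatMap (Branch.step s.1))

/-- Some branch has obligations left. -/
def tableauOpen (s : CondTable × List Branch) : Bool := s.2.any fun b => !b.todo.isEmpty

/-- The answer: no branch describes a counterexample. -/
def tableauAnswer (s : CondTable × List Branch) : Bool := !s.2.any (Branch.accepts s.1)

/-! ### The tableau in polynomial time -/

namespace PolyTime

@[fun_prop]
theorem isConst {f : α → Node} (hf : PolyTime f) : PolyTime fun a => (f a).isConst := by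
  refine comp (of_tree (g := fun x => enc (decide (x.hd = encNat 1))) (f := Node.isConst)
    (by fun_prop) ?_) hf
  rintro (a | x | k | ⟨A, k⟩) <;> simp [Node.isConst, enc, encTerm, encElem, encBool]

@[fun_prop]
theorem ofTerm {f : α → Term} (hf : PolyTime f) : PolyTime fun a => Node.ofTerm (f a) :=
  comp (f := Node.ofTerm) (of_enc_eq (by rintro (a | x) <;> rfl)) hf

@[fun_prop]
theorem nodeVar {f : α → ℕ} (hf : PolyTime f) : PolyTime fun a => Node.var (f a) :=
  comp (f := Node.var) (of_tree (g := fun x => .cons (encNat 0) x) (by fun_prop) fun _ => rfl) hf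

@[fun_prop]
theorem nodeConst {f : α → ℕ} (hf : PolyTime f) : PolyTime fun a => Node.const (f a) :=
  comp (f := Node.const) (of_tree (g := fun x => .cons (encNat 1) x) (by fun_prop) fun _ => rfl) hf

@[fun_prop]
theorem ofElem {f : α → Atom} {g : α → Elem} (hf : PolyTime f) (hg : PolyTime g) :
    PolyTime fun a => Node.ofElem (f a) (g a) := by
  refine comp (f := fun p : Atom × Elem => Node.ofElem p.1 p.2) (of_tree (g := fun x =>
    if x.tl.hd = encNat 0 then .cons (encNat 1) x.tl.tl
    else if x.tl.hd = encNat 1 then .cons (encNat 3) (.cons x.hd x.tl.tl)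
    else x.tl) (by fun_prop) ?_) (pair hf hg)
  rintro ⟨A, a | k | k⟩ <;> simp [Node.ofElem, enc, encTerm, encElem]

@[fun_prop]
theorem resolve {f : α → List (Node × Node)} {g : α → Node} (hf : PolyTime f) (hg : PolyTime g) :
    PolyTime fun a => resolve (f a) (g a) := by
  have key : PolyTime fun s : List (Node × Node) × Node =>
      (([] : List (Node × Node)), s.1.foldl (fun y e => if y = e.1 then e.2 else y) s.2) := by
    refine loop (step := fun s => listElim s.1 s fun e l =>
        (l, if s.2 = e.1 then e.2 else s.2)) (test := fun s => !s.1.isEmpty)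
      ?_ (by fun_prop) (fun s => (enc s).size) X ?_ ?_ (fun s => le_rfl) (by simp)
    · exact listCases (by fun_prop) (by fun_prop) (by fun_prop)
    · rintro ⟨_ | ⟨e, l⟩, x⟩ <;> simp
    · rintro ⟨_ | ⟨e, l⟩, x⟩ <;> simp
      split_ifs <;> omega
  have := key.comp (g := fun a => ((f a).reverse, g a)) (by fun_prop)
  exact (snd this).congr fun a => by simp [DataExchange.resolve]

@[fun_prop]
theorem obligationFormula {f : α → Bool} {g : α → QFFormula} (hf : PolyTime f) (hg : PolyTime g) :
    PolyTime fun a => Obligation.formula (f a) (g a) :=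
  comp (f := fun v => Obligation.formula v.1 v.2) (of_tree (g := fun x => .cons .nil x)
    (by fun_prop) fun _ => rfl) (pair hf hg)

@[fun_prop]
theorem obligationEqn {f g : α → Node} (hf : PolyTime f) (hg : PolyTime g) :
    PolyTime fun a => Obligation.eqn (f a) (g a) :=
  comp (f := fun v => Obligation.eqn v.1 v.2) (of_tree
    (g := fun x => enc (Sum.inr (Sum.inl x : Tree ⊕ Tree) : Tree ⊕ Tree ⊕ Tree))
    (by fun_prop) fun _ => rfl) (pair hf hg)

@[fun_prop]
theorem obligationBind {f : α → ℕ} {g : α → List ℕ} (hf : PolyTime f) (hg : PolyTime g) :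
    PolyTime fun a => Obligation.bind (f a) (g a) :=
  comp (f := fun v => Obligation.bind v.1 v.2) (of_tree
    (g := fun x => enc (Sum.inr (Sum.inr (Sum.inl x)) : Tree ⊕ Tree ⊕ Tree ⊕ Tree))
    (by fun_prop) fun _ => rfl) (pair hf hg)

@[fun_prop]
theorem obligationUnify {f : α → Atom} {g : α → List Term} {h : α → List Elem} (hf : PolyTime f)
    (hg : PolyTime g) (hh : PolyTime h) :
    PolyTime fun a => Obligation.unify (f a) (g a) (h a) :=
  comp (f := fun v => Obligation.unify v.1 v.2.1 v.2.2) (of_tree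
    (g := fun x => enc (Sum.inr (Sum.inr (Sum.inr x)) : Tree ⊕ Tree ⊕ Tree ⊕ Tree))
    (by fun_prop) fun _ => rfl) (pair hf (pair hg hh))

theorem branch_fields : PolyTime fun b : Branch => (b.todo, b.sub, b.pos, b.negRel, b.negEq) :=
  of_enc_eq fun _ => rfl

@[fun_prop]
theorem todo {f : α → Branch} (hf : PolyTime f) : PolyTime fun a => (f a).todo :=
  fst (branch_fields.comp hf)

@[fun_prop]
theorem sub {f : α → Branch} (hf : PolyTime f) : PolyTime fun a => (f a).sub :=
  fst (snd (branch_fields.comp hf))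

@[fun_prop]
theorem pos {f : α → Branch} (hf : PolyTime f) : PolyTime fun a => (f a).pos :=
  fst (snd (snd (branch_fields.comp hf)))

@[fun_prop]
theorem negRel {f : α → Branch} (hf : PolyTime f) : PolyTime fun a => (f a).negRel :=
  fst (snd (snd (snd (branch_fields.comp hf))))

@[fun_prop]
theorem negEq {f : α → Branch} (hf : PolyTime f) : PolyTime fun a => (f a).negEq :=
  snd (snd (snd (snd (branch_fields.comp hf))))

@[fun_prop]
theorem branch_mk {f₁ : α → List Obligation} {f₂ : α → List (Node × Node)} {f₃ f₄ : α → List Atom}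
    {f₅ : α → List (Term × Term)} (h₁ : PolyTime f₁) (h₂ : PolyTime f₂) (h₃ : PolyTime f₃)
    (h₄ : PolyTime f₄) (h₅ : PolyTime f₅) :
    PolyTime fun a => Branch.mk (f₁ a) (f₂ a) (f₃ a) (f₄ a) (f₅ a) :=
  comp (f := fun p => Branch.mk p.1 p.2.1 p.2.2.1 p.2.2.2.1 p.2.2.2.2)
    (of_enc_eq fun _ => rfl) (pair h₁ (pair h₂ (pair h₃ (pair h₄ h₅))))

theorem addEqn : PolyTime fun x : Branch × Node × Node => x.1.addEqn x.2.1 x.2.2 := by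
  unfold Branch.addEqn
  fun_prop

theorem addAtom : PolyTime fun x : CondTable × Branch × Bool × Atom =>
    x.2.1.addAtom x.1 x.2.2.1 x.2.2.2 := by
  unfold Branch.addAtom
  refine ite (by fun_prop) (flatMap (by fun_prop) ?_) (by fun_prop)
  fun_prop

theorem addTermEq : PolyTime fun x : Branch × Bool × Term × Term =>
    x.1.addTermEq x.2.1 x.2.2.1 x.2.2.2 := by
  unfold Branch.addTermEq
  fun_prop

theorem addPair : PolyTime fun x : Branch × Bool × Bool × QFFormula × QFFormula =>
    x.1.addPair x.2.1 x.2.2.1 x.2.2.2.1 x.2.2.2.2 := by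
  unfold Branch.addPair
  fun_prop

theorem sumCases₄ {β₁ β₂ β₃ β₄ : Type} [Enc β₁] [Enc β₂] [Enc β₃] [Enc β₄]
    {f : α → β₁ ⊕ β₂ ⊕ β₃ ⊕ β₄} {g₁ : α × β₁ → δ} {g₂ : α × β₂ → δ} {g₃ : α × β₃ → δ}
    {g₄ : α × β₄ → δ} (hf : PolyTime f) (h₁ : PolyTime g₁) (h₂ : PolyTime g₂) (h₃ : PolyTime g₃)
    (h₄ : PolyTime g₄) :
    PolyTime fun a => Sum.elim (fun b => g₁ (a, b)) (Sum.elim (fun b => g₂ (a, b))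
      (Sum.elim (fun b => g₃ (a, b)) (fun b => g₄ (a, b)))) (f a) := by
  refine sumCases (h := fun p : α × (β₂ ⊕ β₃ ⊕ β₄) => Sum.elim (fun b => g₂ (p.1, b))
    (Sum.elim (fun b => g₃ (p.1, b)) (fun b => g₄ (p.1, b))) p.2) hf h₁ ?_
  refine sumCases (f := fun p : α × (β₂ ⊕ β₃ ⊕ β₄) => p.2) (g := fun q => g₂ (q.1.1, q.2))
    (h := fun q => Sum.elim (fun b => g₃ (q.1.1, b)) (fun b => g₄ (q.1.1, b)) q.2)
    (by fun_prop) (by fun_prop) ?_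
  exact sumCases (f := fun q : (α × (β₂ ⊕ β₃ ⊕ β₄)) × (β₃ ⊕ β₄) => q.2)
    (g := fun q => g₃ (q.1.1.1, q.2)) (h := fun q => g₄ (q.1.1.1, q.2))
    (by fun_prop) (by fun_prop) (by fun_prop)

theorem addFormula : PolyTime fun x : CondTable × Branch × Bool × QFFormula =>
    x.2.1.addFormula x.1 x.2.2.1 x.2.2.2 := by
  have h₁ := addAtom.comp (α := (CondTable × Branch × Bool × QFFormula) × Atom)
    (g := fun p => (p.1.1, p.1.2.1, p.1.2.2.1, p.2)) (by fun_prop)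
  have h₂ := addTermEq.comp (α := (CondTable × Branch × Bool × QFFormula) × Term × Term)
    (g := fun p => (p.1.2.1, p.1.2.2.1, p.2)) (by fun_prop)
  have h₃ : PolyTime fun p : (CondTable × Branch × Bool × QFFormula) × QFFormula =>
      [{ p.1.2.1 with todo := .formula (!p.1.2.2.1) p.2 :: p.1.2.1.todo }] := by fun_prop
  have h₄ := addPair.comp
    (α := (CondTable × Branch × Bool × QFFormula) × Bool × QFFormula × QFFormula)
    (g := fun p => (p.1.2.1, decide (p.1.2.2.1 = p.2.1), p.1.2.2.1, p.2.2)) (by fun_prop)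
  have hv : PolyTime fun x : CondTable × Branch × Bool × QFFormula => x.2.2.2.view :=
    formula_view (by fun_prop)
  exact (sumCases₄ hv h₁ h₂ h₃ h₄).congr fun ⟨T, b, pol, φ⟩ => by
    cases φ <;> cases pol <;> rfl

theorem addBind : PolyTime fun x : Branch × ℕ × List ℕ => x.1.addBind x.2.1 x.2.2 := by
  have : PolyTime fun x : Branch × ℕ × List ℕ => listElim x.2.2 [x.1] fun a ts =>
      [{ x.1 with todo := .eqn (.var x.2.1) (.const a) :: .bind (x.2.1 + 1) ts :: x.1.todo }] :=
    listCases (by fun_prop) (by fun_prop) (by fun_prop)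
  exact this.congr fun ⟨b, i, ts⟩ => by cases ts <;> rfl

theorem addUnify : PolyTime fun x : Branch × Atom × List Term × List Elem =>
    x.1.addUnify x.2.1 x.2.2.1 x.2.2.2 := by
  have : PolyTime fun x : Branch × Atom × List Term × List Elem =>
      listElim x.2.2.1 (listElim x.2.2.2 [x.1] fun _ _ => []) fun s ss =>
        listElim x.2.2.2 [] fun e es =>
          [{ x.1 with
            todo := .eqn (.ofTerm s) (.ofElem x.2.1 e) :: .unify x.2.1 ss es :: x.1.todo }] :=
    listCases (by fun_prop) (listCases (by fun_prop) (by fun_prop) (by fun_prop))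
      (listCases (by fun_prop) (by fun_prop) (by fun_prop))
  exact this.congr fun ⟨b, A, ss, es⟩ => by cases ss <;> cases es <;> rfl

theorem add : PolyTime fun x : CondTable × Branch × Obligation => x.2.1.add x.1 x.2.2 := by
  have h₁ := addFormula.comp (α := (CondTable × Branch × Obligation) × Bool × QFFormula)
    (g := fun p => (p.1.1, p.1.2.1, p.2)) (by fun_prop)
  have h₂ := addEqn.comp (α := (CondTable × Branch × Obligation) × Node × Node)
    (g := fun p => (p.1.2.1, p.2)) (by fun_prop)
  have h₃ := addBind.comp (α := (CondTable × Branch × Obligation) × ℕ × List ℕ)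
    (g := fun p => (p.1.2.1, p.2)) (by fun_prop)
  have h₄ := addUnify.comp (α := (CondTable × Branch × Obligation) × Atom × List Term × List Elem)
    (g := fun p => (p.1.2.1, p.2)) (by fun_prop)
  have hv : PolyTime fun x : CondTable × Branch × Obligation => x.2.2.view :=
    comp (f := Obligation.view) (of_enc_eq fun _ => rfl) (by fun_prop)
  exact (sumCases₄ hv h₁ h₂ h₃ h₄).congr fun ⟨T, b, o⟩ => by cases o <;> rfl

theorem branchStep : PolyTime fun x : CondTable × Branch => x.2.step x.1 := by
  have : PolyTime fun p : (CondTable × Branch) × Obligation × List Obligation =>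
      ({ p.1.2 with todo := p.2.2 } : Branch).add p.1.1 p.2.1 :=
    add.comp (g := fun p : (CondTable × Branch) × Obligation × List Obligation =>
      (p.1.1, ({ p.1.2 with todo := p.2.2 } : Branch), p.2.1)) (by fun_prop)
  have : PolyTime fun x : CondTable × Branch => listElim x.2.todo [x.2] fun o os =>
      ({ x.2 with todo := os } : Branch).add x.1 o :=
    listCases (by fun_prop) (by fun_prop) this
  exact this.congr fun ⟨T, b⟩ => by
    unfold Branch.step
    dsimp only
    cases b.todo <;> rfl

theorem branchAccepts : PolyTime fun x : CondTable × Branch => x.2.accepts x.1 := by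
  unfold Branch.accepts Branch.copies
  refine and ?_ (and ?_ ?_)
  · refine all (by fun_prop) (any (by fun_prop) (all (by fun_prop) (all (by fun_prop) ?_)))
    fun_prop
  · refine all (by fun_prop) (all (by fun_prop) (all (by fun_prop)
      (decide_not (decide_and (by fun_prop) (decide_eq (map (by fun_prop) ?_)
        (map (by fun_prop) ?_)))))) <;> fun_prop
  · refine all (by fun_prop) ?_
    fun_prop

theorem initial : PolyTime initial := by
  unfold DataExchange.initial
  fun_prop

theorem tableauStep : PolyTime tableauStep :=
  pair (fst id) (flatMap (by fun_prop) (branchStep.comp (g := fun p :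
    (CondTable × List Branch) × Branch => (p.1.1, p.2)) (by fun_prop)))

theorem tableauOpen : PolyTime tableauOpen := by
  refine any (by fun_prop) ?_
  fun_prop

theorem tableauAnswer : PolyTime tableauAnswer :=
  not (any (by fun_prop) (branchAccepts.comp (g := fun p :
    (CondTable × List Branch) × Branch => (p.1.1, p.2)) (by fun_prop)))

end PolyTime

/-- A loop that starts from a state depending on two inputs is slicewise polynomial: if it stops
after a number of steps that is bounded for each first input, then for each first input the cost is
polynomial in the size of the second input. -/
theorem exists_slicewise_loop {init : α × β → σ} {step : σ → σ} {test : σ → Bool} {out : σ → γ}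
    (hi : PolyTime init) (hs : PolyTime step) (ht : PolyTime test) (ho : PolyTime out) :
    ∃ P : Prog, ∀ (a : α) (N : ℕ), ∃ p : ℕ[X], ∀ b, test (step^[N] (init (a, b))) = false →
      ∃ i ≤ N, test (step^[i] (init (a, b))) = false ∧
        RunsIn P (enc (a, b)) (enc (out (step^[i] (init (a, b))))) (p.eval (enc b).size) := by
  obtain ⟨P, p, hP⟩ := hi
  obtain ⟨L, l, hL⟩ := PolyTime.exists_loop hs ht
  obtain ⟨O, o, hO⟩ := ho
  obtain ⟨f, hf⟩ := hs.size_le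
  refine ⟨.comp P (.comp L O), fun a N => ?_⟩
  -- the size of the state remains polynomial, since the number of steps does not depend on `b`
  have hsize : ∀ n : ℕ, ∃ r : ℕ[X], ∀ b, ∀ i ≤ n,
      (enc (step^[i] (init (a, b)))).size ≤ r.eval (enc b).size := by
    intro n
    induction n with
    | zero =>
      refine ⟨p.comp (C (1 + (enc a).size) + X), fun b i hi => ?_⟩
      obtain rfl : i = 0 := by omega
      simpa using (hP (a, b)).size_le
    | succ n ih =>
      obtain ⟨r, hr⟩ := ih
      refine ⟨r + f.comp r, fun b i hi => ?_⟩
      simp only [eval_add, eval_comp]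
      rcases Nat.lt_or_ge n i with h | h
      · obtain rfl : i = n + 1 := by omega
        rw [Function.iterate_succ_apply']
        have := (hf _).trans (eval_le_eval f (hr b n le_rfl))
        omega
      · have := hr b i h
        omega
  obtain ⟨r, hr⟩ := hsize N
  refine ⟨1 + p.comp (C (1 + (enc a).size) + X) + (1 + C (N + 1) * l.comp r + o.comp r),
    fun b hb => ?_⟩
  obtain ⟨i, hi, hti, hrun⟩ := hL N _ _ (hr b) hb
  refine ⟨i, hi, hti, ((hP (a, b)).comp (hrun.comp (hO _))).mono ?_⟩
  have := eval_le_eval o (hr b i hi)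
  simp only [eval_add, eval_mul, eval_one, eval_C, eval_comp, eval_X, enc_prod, Tree.size]
  omega

/-! ### Termination of the tableau -/

/-- A bound for the number of steps that a formula gives rise to on a branch. -/
def QFFormula.weight : QFFormula → ℕ
  | .rel A => 2 + 2 * A.args.length
  | .eq _ _ => 2
  | .neg β => 1 + β.weight
  | .and β γ => 1 + β.weight + γ.weight
  | .or β γ => 1 + β.weight + γ.weight

def Obligation.weight : Obligation → ℕ
  | .formula _ φ => φ.weight
  | .eqn _ _ => 1
  | .bind _ ts => 1 + 2 * ts.length
  | .unify _ ss _ => 1 + 2 * ss.length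

/-- It decreases in every step until no obligations remain, and does not depend on the table. -/
def Branch.weight (b : Branch) : ℕ := (b.todo.map Obligation.weight).sum

theorem Obligation.weight_pos (o : Obligation) : 0 < o.weight := by
  rcases o with ⟨pol, _ | _ | _ | _ | _⟩ | _ | _ | _ <;>
    simp only [Obligation.weight, QFFormula.weight] <;> omega

theorem Branch.weight_add {T : CondTable} {b b' : Branch} {o : Obligation} (h : b' ∈ b.add T o) :
    b'.weight < o.weight + b.weight := by
  rcases o with ⟨pol, φ⟩ | ⟨x, y⟩ | ⟨i, ts⟩ | ⟨A, ss, es⟩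
  · cases φ <;> simp only [Branch.add, Branch.addFormula, Branch.addAtom, Branch.addTermEq,
      Branch.addPair] at h
    · split_ifs at h
      · simp only [List.mem_flatMap, List.mem_ite_nil_right, List.mem_singleton] at h
        obtain ⟨f, -, -, rfl⟩ := h
        simp only [Branch.weight, Obligation.weight, QFFormula.weight, List.map_cons, List.sum_cons]
        omega
      · simp only [List.mem_singleton] at h
        subst h
        simp only [Branch.weight, Obligation.weight, QFFormula.weight]
        omega
    all_goals
      try split_ifs at h
      all_goals
        simp only [List.mem_cons, List.not_mem_nil, or_false] at h
        (first | subst h | rcases h with rfl | rfl) <;>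
          simp only [Branch.weight, Obligation.weight, QFFormula.weight, List.map_cons,
            List.sum_cons] <;> omega
  · simp only [Branch.add, Branch.addEqn] at h
    split_ifs at h <;> simp only [List.mem_cons, List.not_mem_nil, or_false] at h <;> subst h <;>
      simp only [Branch.weight, Obligation.weight] <;> omega
  · cases ts <;> simp only [Branch.add, Branch.addBind, List.mem_singleton] at h <;> subst h <;>
      simp only [Branch.weight, Obligation.weight, List.map_cons, List.sum_cons, List.length_cons,
        List.length_nil] <;> omega
  · cases ss <;> cases es <;>
      simp only [Branch.add, Branch.addUnify, List.mem_singleton, List.not_mem_nil] at h <;>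
      subst h <;>
      simp only [Branch.weight, Obligation.weight, List.map_cons, List.sum_cons, List.length_cons,
        List.length_nil] <;> omega

theorem Branch.weight_step {T : CondTable} {b b' : Branch} (h : b' ∈ b.step T) :
    b'.weight ≤ b.weight - 1 := by
  obtain ⟨_ | ⟨o, os⟩, s, p, nr, ne⟩ := b
  · simp only [Branch.step, List.mem_singleton] at h
    subst h
    simp [Branch.weight]
  · have := Branch.weight_add h
    simp only [Branch.weight, List.map_cons, List.sum_cons] at this ⊢
    omega

/-! ### Correctness of the tableau -/

/-- The obligation is satisfied by the instance `J` and the valuation `val` of the nodes. -/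
def Obligation.Holds (J : Set (Fact Cons)) (val : Node → Cons) : Obligation → Prop
  | .formula pol φ => φ.Holds J (fun x => val (.var x)) ↔ pol = true
  | .eqn x y => val x = val y
  | .bind i ts => ∀ j a, ts[j]? = some a → val (.var (i + j)) = a
  | .unify A ss es => (ss.map fun s => val (.ofTerm s)) = es.map fun e => val (.ofElem A e)

/-- The instance `J` and the valuation `val` satisfy all that the branch requires. -/
structure Branch.Holds (T : CondTable) (J : Set (Fact Cons)) (val : Node → Cons) (b : Branch) :
    Prop where
  todo : ∀ o ∈ b.todo, o.Holds J val
  sub : ∀ e ∈ b.sub, val e.1 = val e.2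
  pos : ∀ A ∈ b.pos, ∀ f ∈ T.facts, f.map (fun e => val (.ofElem A e)) ∈ J
  negRel : ∀ A ∈ b.negRel, A.inst (fun x => val (.var x)) ∉ J
  negEq : ∀ e ∈ b.negEq, val (.ofTerm e.1) ≠ val (.ofTerm e.2)

section

variable {T : CondTable} {J : Set (Fact Cons)} {val : Node → Cons} {b b' : Branch}

theorem val_ofTerm (hc : ∀ a, val (.const a) = a) (s : Term) :
    s.val (fun x => val (.var x)) = val (.ofTerm s) := by
  cases s <;> simp [Term.val, Node.ofTerm, hc]

theorem val_ofElem (hc : ∀ a, val (.const a) = a) (A : Atom) (e : Elem) :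
    e.val (fun k => val (.clo k)) (fun k => val (.opn A k)) = val (.ofElem A e) := by
  cases e <;> simp [Elem.val, Node.ofElem, hc]

theorem inst_eq (hc : ∀ a, val (.const a) = a) (A : Atom) :
    A.inst (fun x => val (.var x)) = ⟨A.rel, A.args.map fun s => val (.ofTerm s)⟩ := by
  simp only [Atom.inst, Fact.mk.injEq, true_and]
  exact List.map_congr_left fun s _ => val_ofTerm hc s

/-- A substitution does not change the value of a node under a solution of its equations. -/
theorem val_resolve {s : List (Node × Node)} (hs : ∀ e ∈ s, val e.1 = val e.2) (x : Node) :
    val (resolve s x) = val x := by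
  induction s with
  | nil => rfl
  | cons e s ih =>
    have ih := ih fun e he => hs e (List.mem_cons_of_mem _ he)
    change val (if resolve s x = e.1 then e.2 else resolve s x) = val x
    split_ifs with h
    · rw [← hs e List.mem_cons_self, ← h, ih]
    · exact ih

/-- A model of a branch that arises from an obligation is a model of the original branch and
satisfies the obligation. -/
theorem Branch.Holds.of_add {o : Obligation} (hc : ∀ a, val (.const a) = a)
    (h : b' ∈ b.add T o) (hb : b'.Holds T J val) : b.Holds T J val ∧ o.Holds J val := by
  obtain ⟨h₁, h₂, h₃, h₄, h₅⟩ := hb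
  rcases o with ⟨pol, φ⟩ | ⟨x, y⟩ | ⟨i, ts⟩ | ⟨A, ss, es⟩
  · cases φ with
    | rel A =>
      simp only [Branch.add, Branch.addFormula, Branch.addAtom] at h
      split_ifs at h with hp
      · simp only [List.mem_flatMap, List.mem_ite_nil_right, List.mem_singleton] at h
        obtain ⟨f, hf, hr, rfl⟩ := h
        simp only [List.mem_cons, forall_eq_or_imp] at h₁ h₃
        refine ⟨⟨h₁.2, h₂, h₃.2, h₄, h₅⟩, ?_⟩
        have := h₃.1 f hf
        simp only [Obligation.Holds, QFFormula.Holds, hp, iff_true]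
        rw [inst_eq hc, h₁.1, ← hr]
        exact this
      · simp only [List.mem_singleton] at h
        subst h
        simp only [List.mem_cons, forall_eq_or_imp] at h₄
        exact ⟨⟨h₁, h₂, h₃, h₄.2, h₅⟩, by simpa [Obligation.Holds, QFFormula.Holds, hp] using h₄.1⟩
    | eq s t =>
      simp only [Branch.add, Branch.addFormula, Branch.addTermEq] at h
      split_ifs at h with hp <;> simp only [List.mem_singleton] at h <;> subst h
      · simp only [List.mem_cons, forall_eq_or_imp] at h₁
        refine ⟨⟨h₁.2, h₂, h₃, h₄, h₅⟩, ?_⟩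
        simpa [Obligation.Holds, QFFormula.Holds, hp, val_ofTerm hc] using h₁.1
      · simp only [List.mem_cons, forall_eq_or_imp] at h₅
        refine ⟨⟨h₁, h₂, h₃, h₄, h₅.2⟩, ?_⟩
        simpa [Obligation.Holds, QFFormula.Holds, hp, val_ofTerm hc] using h₅.1
    | neg β =>
      simp only [Branch.add, Branch.addFormula, List.mem_singleton] at h
      subst h
      simp only [List.mem_cons, forall_eq_or_imp] at h₁
      refine ⟨⟨h₁.2, h₂, h₃, h₄, h₅⟩, ?_⟩
      have := h₁.1
      cases pol <;> simpa [Obligation.Holds, QFFormula.Holds] using this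
    | _ β γ =>
      cases pol <;> simp [Branch.add, Branch.addFormula, Branch.addPair] at h <;>
        first
        | (rcases h with h | h) <;> subst h <;>
            simp only [List.mem_cons, forall_eq_or_imp] at h₁ <;>
            refine ⟨⟨h₁.2, h₂, h₃, h₄, h₅⟩, ?_⟩ <;>
            have := h₁.1 <;> simp_all [Obligation.Holds, QFFormula.Holds]
        | subst h
          simp only [List.mem_cons, forall_eq_or_imp] at h₁
          refine ⟨⟨h₁.2.2, h₂, h₃, h₄, h₅⟩, ?_⟩
          have := h₁.1
          have := h₁.2.1
          simp_all [Obligation.Holds, QFFormula.Holds]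
  · simp only [Branch.add, Branch.addEqn] at h
    split_ifs at h <;> simp only [List.mem_cons, List.not_mem_nil, or_false] at h <;> subst h
    · simp only [List.mem_cons, forall_eq_or_imp] at h₂
      obtain ⟨h₂, h₂'⟩ := h₂
      rw [val_resolve h₂', val_resolve h₂'] at h₂
      exact ⟨⟨h₁, h₂', h₃, h₄, h₅⟩, h₂⟩
    · simp only [List.mem_cons, forall_eq_or_imp] at h₂
      obtain ⟨h₂, h₂'⟩ := h₂
      rw [val_resolve h₂', val_resolve h₂'] at h₂
      exact ⟨⟨h₁, h₂', h₃, h₄, h₅⟩, h₂.symm⟩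
    · rename_i hxy
      refine ⟨⟨h₁, h₂, h₃, h₄, h₅⟩, ?_⟩
      have := congrArg val hxy
      rwa [val_resolve h₂, val_resolve h₂] at this
  · cases ts with
    | nil =>
      simp only [Branch.add, Branch.addBind, List.mem_singleton] at h
      subst h
      exact ⟨⟨h₁, h₂, h₃, h₄, h₅⟩, by simp [Obligation.Holds]⟩
    | cons a ts =>
      simp only [Branch.add, Branch.addBind, List.mem_singleton] at h
      subst h
      simp only [List.mem_cons, forall_eq_or_imp] at h₁
      refine ⟨⟨h₁.2.2, h₂, h₃, h₄, h₅⟩, ?_⟩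
      rintro (_ | j) c hj
      · have := h₁.1
        simp_all [Obligation.Holds]
      · have := h₁.2.1 j c (by simpa using hj)
        rwa [add_assoc, add_comm 1] at this
  · cases ss <;> cases es <;>
      simp only [Branch.add, Branch.addUnify, List.mem_singleton, List.not_mem_nil] at h <;>
      subst h
    · exact ⟨⟨h₁, h₂, h₃, h₄, h₅⟩, by simp [Obligation.Holds]⟩
    · simp only [List.mem_cons, forall_eq_or_imp] at h₁
      refine ⟨⟨h₁.2.2, h₂, h₃, h₄, h₅⟩, ?_⟩
      have := h₁.1
      have := h₁.2.1
      simp_all [Obligation.Holds]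

/-- A model in which each true atom is a fact of the table in the copy for this atom survives on
some branch. -/
theorem Branch.Holds.add {o : Obligation} (hc : ∀ a, val (.const a) = a)
    (hJ : ∀ A, ∀ f ∈ T.facts, f.map (fun e => val (.ofElem A e)) ∈ J)
    (hA : ∀ A : Atom, A.inst (fun x => val (.var x)) ∈ J →
      ∃ f ∈ T.facts, A.inst (fun x => val (.var x)) = f.map (fun e => val (.ofElem A e)))
    (hb : b.Holds T J val) (ho : o.Holds J val) : ∃ b' ∈ b.add T o, b'.Holds T J val := by
  obtain ⟨h₁, h₂, h₃, h₄, h₅⟩ := hb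
  rcases o with ⟨pol, φ⟩ | ⟨x, y⟩ | ⟨i, ts⟩ | ⟨A, ss, es⟩
  · cases φ with
    | rel A =>
      simp only [Obligation.Holds, QFFormula.Holds] at ho
      simp only [Branch.add, Branch.addFormula, Branch.addAtom]
      split_ifs with hp
      · obtain ⟨f, hf, he⟩ := hA A (ho.2 hp)
        rw [inst_eq hc, Fact.map, Fact.mk.injEq] at he
        refine ⟨{ b with todo := .unify A A.args f.args :: b.todo, pos := A :: b.pos },
          List.mem_flatMap.2 ⟨f, hf, by simp [he.1]⟩, ?_, h₂, ?_, h₄, h₅⟩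
        · simpa using ⟨he.2, h₁⟩
        · simpa using ⟨hJ A, h₃⟩
      · refine ⟨_, List.mem_singleton_self _, h₁, h₂, h₃, ?_, h₅⟩
        simpa using ⟨fun h => hp (ho.1 h), h₄⟩
    | eq s t =>
      simp only [Obligation.Holds, QFFormula.Holds, val_ofTerm hc] at ho
      simp only [Branch.add, Branch.addFormula, Branch.addTermEq]
      split_ifs with hp
      · refine ⟨_, List.mem_singleton_self _, ?_, h₂, h₃, h₄, h₅⟩
        simpa using ⟨ho.2 hp, h₁⟩
      · refine ⟨_, List.mem_singleton_self _, h₁, h₂, h₃, h₄, ?_⟩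
        rintro e he
        rcases List.mem_cons.1 he with rfl | he
        · exact fun h => hp (ho.1 h)
        · exact h₅ e he
    | neg β =>
      refine ⟨_, List.mem_singleton_self _, ?_, h₂, h₃, h₄, h₅⟩
      simp only [List.mem_cons, forall_eq_or_imp]
      refine ⟨?_, h₁⟩
      cases pol <;> simpa [Obligation.Holds, QFFormula.Holds] using ho
    | and β γ =>
      cases pol <;> simp only [Obligation.Holds, QFFormula.Holds, Bool.false_eq_true, iff_false,
        iff_true, not_and_or] at ho <;> simp only [Branch.add, Branch.addFormula, Branch.addPair,
        if_true, Bool.false_eq_true, if_false]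
      · rcases ho with ho | ho
        · refine ⟨_, List.mem_cons_self, ?_, h₂, h₃, h₄, h₅⟩
          simpa [Obligation.Holds] using ⟨ho, h₁⟩
        · refine ⟨_, List.mem_cons_of_mem _ (List.mem_singleton_self _), ?_, h₂, h₃, h₄, h₅⟩
          simpa [Obligation.Holds] using ⟨ho, h₁⟩
      · refine ⟨_, List.mem_singleton_self _, ?_, h₂, h₃, h₄, h₅⟩
        simpa [Obligation.Holds] using ⟨ho.1, ho.2, h₁⟩
    | or β γ =>
      cases pol <;> simp only [Obligation.Holds, QFFormula.Holds, Bool.false_eq_true, iff_false,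
        iff_true, not_or] at ho <;> simp only [Branch.add, Branch.addFormula, Branch.addPair,
        Bool.not_true, Bool.not_false, if_true, Bool.false_eq_true, if_false]
      · refine ⟨_, List.mem_singleton_self _, ?_, h₂, h₃, h₄, h₅⟩
        simpa [Obligation.Holds] using ⟨ho.1, ho.2, h₁⟩
      · rcases ho with ho | ho
        · refine ⟨_, List.mem_cons_self, ?_, h₂, h₃, h₄, h₅⟩
          simpa [Obligation.Holds] using ⟨ho, h₁⟩
        · refine ⟨_, List.mem_cons_of_mem _ (List.mem_singleton_self _), ?_, h₂, h₃, h₄, h₅⟩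
          simpa [Obligation.Holds] using ⟨ho, h₁⟩
  · have hxy : val (resolve b.sub x) = val (resolve b.sub y) := by
      rw [val_resolve h₂, val_resolve h₂]; exact ho
    simp only [Branch.add, Branch.addEqn]
    split_ifs with hx hy h
    · refine ⟨_, List.mem_singleton_self _, h₁, ?_, h₃, h₄, h₅⟩
      simpa using ⟨hxy, fun a b h => h₂ (a, b) h⟩
    · refine ⟨_, List.mem_singleton_self _, h₁, ?_, h₃, h₄, h₅⟩
      simpa using ⟨hxy.symm, fun a b h => h₂ (a, b) h⟩
    · exact ⟨b, List.mem_singleton_self _, h₁, h₂, h₃, h₄, h₅⟩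
    · -- two different constants have different values
      cases hx' : resolve b.sub x <;> cases hy' : resolve b.sub y <;>
        simp_all [Node.isConst]
  · cases ts with
    | nil => exact ⟨b, List.mem_singleton_self _, h₁, h₂, h₃, h₄, h₅⟩
    | cons a ts =>
      refine ⟨_, List.mem_singleton_self _, ?_, h₂, h₃, h₄, h₅⟩
      simp only [List.mem_cons, forall_eq_or_imp]
      refine ⟨?_, fun j c hj => ?_, h₁⟩
      · simpa [Obligation.Holds, hc] using ho 0 a rfl
      · have := ho (j + 1) c (by simpa using hj)
        rwa [add_comm j, ← add_assoc] at this
  · cases ss <;> cases es <;> simp only [Obligation.Holds, List.map_nil, List.map_cons,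
      List.cons.injEq, reduceCtorEq] at ho
    · exact ⟨b, List.mem_singleton_self _, h₁, h₂, h₃, h₄, h₅⟩
    · refine ⟨_, List.mem_singleton_self _, ?_, h₂, h₃, h₄, h₅⟩
      simpa [Obligation.Holds] using ⟨ho.1, ho.2, h₁⟩

theorem Branch.Holds.of_step (hc : ∀ a, val (.const a) = a) (h : b' ∈ b.step T)
    (hb : b'.Holds T J val) : b.Holds T J val := by
  obtain ⟨_ | ⟨o, os⟩, s, p, nr, ne⟩ := b
  · simp only [Branch.step, List.mem_singleton] at h
    exact h ▸ hb
  · obtain ⟨⟨h₁, h₂, h₃, h₄, h₅⟩, ho⟩ := Branch.Holds.of_add hc h hb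
    exact ⟨by simpa using ⟨ho, h₁⟩, h₂, h₃, h₄, h₅⟩

theorem Branch.Holds.step (hc : ∀ a, val (.const a) = a)
    (hJ : ∀ A, ∀ f ∈ T.facts, f.map (fun e => val (.ofElem A e)) ∈ J)
    (hA : ∀ A : Atom, A.inst (fun x => val (.var x)) ∈ J →
      ∃ f ∈ T.facts, A.inst (fun x => val (.var x)) = f.map (fun e => val (.ofElem A e)))
    (hb : b.Holds T J val) : ∃ b' ∈ b.step T, b'.Holds T J val := by
  obtain ⟨_ | ⟨o, os⟩, s, p, nr, ne⟩ := b
  · exact ⟨_, List.mem_singleton_self _, hb⟩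
  · obtain ⟨h₁, h₂, h₃, h₄, h₅⟩ := hb
    simp only [List.mem_cons, forall_eq_or_imp] at h₁
    exact Branch.Holds.add (b := ⟨os, s, p, nr, ne⟩) hc hJ hA ⟨h₁.2, h₂, h₃, h₄, h₅⟩ h₁.1

end

/-- Each binding of the substitution is between nodes that the older bindings do not change, and
does not bind a constant. -/
def Triangular : List (Node × Node) → Prop
  | [] => True
  | e :: s => Triangular s ∧ e.1.isConst = false ∧ resolve s e.1 = e.1 ∧ resolve s e.2 = e.2

theorem resolve_cons (e : Node × Node) (s : List (Node × Node)) (x : Node) :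
    resolve (e :: s) x = if resolve s x = e.1 then e.2 else resolve s x := rfl

theorem Triangular.resolve_resolve {s : List (Node × Node)} (hs : Triangular s) (x : Node) :
    resolve s (resolve s x) = resolve s x := by
  induction s with
  | nil => rfl
  | cons e s ih =>
    obtain ⟨hs, -, h₁, h₂⟩ := hs
    simp only [resolve_cons]
    split_ifs <;> simp_all

theorem Triangular.resolve_const {s : List (Node × Node)} (hs : Triangular s) (a : Cons) :
    resolve s (.const a) = .const a := by
  induction s with
  | nil => rfl
  | cons e s ih =>
    obtain ⟨hs, hc, -⟩ := hs
    rw [resolve_cons, ih hs, if_neg]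
    rintro h
    simp [← h, Node.isConst] at hc

theorem Triangular.resolve_eq {s : List (Node × Node)} (hs : Triangular s) {e : Node × Node}
    (he : e ∈ s) : resolve s e.1 = resolve s e.2 := by
  induction s with
  | nil => simp at he
  | cons d s ih =>
    obtain ⟨hs, -, h₁, h₂⟩ := hs
    simp only [resolve_cons]
    rcases List.mem_cons.1 he with rfl | he
    · simp [h₁, h₂]
    · rw [ih hs he]

theorem Branch.triangular_add {T : CondTable} {b b' : Branch} {o : Obligation}
    (h : b' ∈ b.add T o) (hb : Triangular b.sub) : Triangular b'.sub := by
  rcases o with ⟨pol, φ⟩ | ⟨x, y⟩ | ⟨i, ts⟩ | ⟨A, ss, es⟩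
  · suffices b'.sub = b.sub by rwa [this]
    cases φ <;> simp only [Branch.add, Branch.addFormula, Branch.addAtom, Branch.addTermEq,
      Branch.addPair] at h
    · split_ifs at h
      · simp only [List.mem_flatMap, List.mem_ite_nil_right, List.mem_singleton] at h
        obtain ⟨f, -, -, rfl⟩ := h
        rfl
      · rw [List.mem_singleton.1 h]
    all_goals
      try split_ifs at h
      all_goals
        simp only [List.mem_cons, List.not_mem_nil, or_false] at h
        (first | subst h | rcases h with rfl | rfl) <;> rfl
  · simp only [Branch.add, Branch.addEqn] at h
    split_ifs at h with hx hy <;> simp only [List.mem_cons, List.not_mem_nil, or_false] at h <;>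
      subst h
    · exact ⟨hb, hx, hb.resolve_resolve x, hb.resolve_resolve y⟩
    · exact ⟨hb, hy, hb.resolve_resolve y, hb.resolve_resolve x⟩
    · exact hb
  · cases ts <;> simp only [Branch.add, Branch.addBind, List.mem_singleton] at h <;> subst h <;>
      exact hb
  · cases ss <;> cases es <;>
      simp only [Branch.add, Branch.addUnify, List.mem_singleton, List.not_mem_nil] at h <;>
      subst h <;> exact hb

theorem Branch.triangular_step {T : CondTable} {b b' : Branch} (h : b' ∈ b.step T)
    (hb : Triangular b.sub) : Triangular b'.sub := by
  obtain ⟨_ | ⟨o, os⟩, s, p, nr, ne⟩ := b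
  · simp only [Branch.step, List.mem_singleton] at h
    exact h ▸ hb
  · exact Branch.triangular_add (b := ⟨os, s, p, nr, ne⟩) h hb

/-! ### The most general solution -/

instance : Countable Term :=
  Function.Injective.countable (β := ℕ ⊕ ℕ)
    (f := fun | .var x => .inl x | .const a => .inr a)
    (by rintro (x | x) (y | y) h <;> simp_all)

instance : Countable Atom :=
  Function.Injective.countable (f := fun A : Atom => (A.rel, A.args))
    (by rintro ⟨r, s⟩ ⟨r', s'⟩ h; simp_all)

instance : Countable Node :=
  Function.Injective.countable (β := (ℕ ⊕ ℕ) ⊕ ℕ ⊕ (Atom × ℕ))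
    (f := fun
      | .const a => .inl (.inl a)
      | .var x => .inl (.inr x)
      | .clo k => .inr (.inl k)
      | .opn A k => .inr (.inr (A, k)))
    (by rintro (a | x | k | ⟨A, k⟩) (b | y | l | ⟨B, l⟩) h <;> simp_all)

/-- The valuation that gives different values to different nodes, as long as the constants
that are involved are smaller than `m`. -/
noncomputable def freshVal (m : ℕ) (x : Node) : Cons :=
  match x with
  | .const a => a
  | x => m + (exists_injective_nat Node).choose x

theorem freshVal_of_isConst_eq_false {x : Node} (h : x.isConst = false) (m : ℕ) :
    freshVal m x = m + (exists_injective_nat Node).choose x := by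
  cases x <;> simp_all [freshVal, Node.isConst]

open Filter in
theorem eventually_freshVal_ne {x y : Node} (h : x ≠ y) :
    ∀ᶠ m in atTop, freshVal m x ≠ freshVal m y := by
  have key : ∀ a (y : Node), y.isConst = false → ∀ᶠ m in atTop, a ≠ freshVal m y := by
    intro a y hy
    filter_upwards [eventually_gt_atTop a] with m hm
    rw [freshVal_of_isConst_eq_false hy]
    exact (hm.trans_le (Nat.le_add_right _ _)).ne
  rcases hx : x.isConst with _ | _ <;> rcases hy : y.isConst with _ | _
  · refine Eventually.of_forall fun m => ?_
    rw [freshVal_of_isConst_eq_false hx, freshVal_of_isConst_eq_false hy]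
    exact fun h' => h ((exists_injective_nat Node).choose_spec (Nat.add_left_cancel h'))
  · cases y <;> simp [Node.isConst] at hy
    filter_upwards [key _ x hx] with m hm using hm.symm
  · cases x <;> simp [Node.isConst] at hx
    filter_upwards [key _ y hy] with m hm using hm
  · cases x <;> simp [Node.isConst] at hx
    cases y <;> simp [Node.isConst] at hy
    exact Eventually.of_forall fun m h' => h (congrArg _ h')

open Filter in
theorem eventually_map_freshVal_ne {l l' : List Node} (h : l ≠ l') :
    ∀ᶠ m in atTop, l.map (freshVal m) ≠ l'.map (freshVal m) := by
  induction l generalizing l' with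
  | nil => cases l' <;> simp_all
  | cons x l ih =>
    cases l' with
    | nil => simp
    | cons y l' =>
      by_cases hxy : x = y
      · filter_upwards [ih (l' := l') (by rintro rfl; exact h (by rw [hxy]))] with m hm
        simp [hm]
      · filter_upwards [eventually_freshVal_ne hxy] with m hm
        simp [hm]

open Filter in
theorem eventually_forall_mem {α : Type} {l : List α} {p : α → ℕ → Prop}
    (h : ∀ a ∈ l, ∀ᶠ m in atTop, p a m) : ∀ᶠ m in atTop, ∀ a ∈ l, p a m :=
  (eventually_all_finite (List.finite_toSet l)).2 h

open Filter in
/-- An accepted branch without obligations has a model that is represented by the table: the most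
general solution of its equations, with one valuation of the open nulls for each copy. -/
theorem Branch.exists_holds {T : CondTable} {b : Branch} (hb : b.todo = [])
    (hs : Triangular b.sub) (ha : b.accepts T = true) :
    ∃ J ∈ T.Rep, ∃ val : Node → Cons, (∀ a, val (.const a) = a) ∧ b.Holds T J val := by
  simp only [Branch.accepts, Bool.and_eq_true, List.all_eq_true, List.any_eq_true,
    decide_eq_true_eq] at ha
  obtain ⟨h₁, h₂, h₃⟩ := ha
  -- a valuation for which different resolved nodes that are compared have different values
  obtain ⟨m, h₁, h₂, h₃⟩ : ∃ m : ℕ,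
      (∀ d ∈ T.cond, ∃ e ∈ d, ∀ A ∈ b.copies, ∀ B ∈ b.copies,
        freshVal m (resolve b.sub (.ofElem A e.1)) ≠ freshVal m (resolve b.sub (.ofElem B e.2))) ∧
      (∀ N ∈ b.negRel, ∀ f ∈ T.facts, ∀ A ∈ b.copies, ¬ (N.rel = f.rel ∧
        (N.args.map fun s => freshVal m (resolve b.sub (.ofTerm s))) =
          f.args.map fun e => freshVal m (resolve b.sub (.ofElem A e)))) ∧
      ∀ e ∈ b.negEq, freshVal m (resolve b.sub (.ofTerm e.1)) ≠
        freshVal m (resolve b.sub (.ofTerm e.2)) := by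
    refine Eventually.exists (f := atTop) (Eventually.and ?_ (Eventually.and ?_ ?_))
    · refine eventually_forall_mem fun d hd => ?_
      obtain ⟨e, he, h⟩ := h₁ d hd
      have : ∀ᶠ m in atTop, ∀ A ∈ b.copies, ∀ B ∈ b.copies,
          freshVal m (resolve b.sub (.ofElem A e.1)) ≠
            freshVal m (resolve b.sub (.ofElem B e.2)) :=
        eventually_forall_mem fun A hA => eventually_forall_mem fun B hB =>
          eventually_freshVal_ne (h A hA B hB)
      exact this.mono fun m hm => ⟨e, he, hm⟩
    · refine eventually_forall_mem fun N hN => eventually_forall_mem fun f hf =>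
        eventually_forall_mem fun A hA => ?_
      by_cases hr : N.rel = f.rel
      · have := eventually_map_freshVal_ne fun h => h₂ N hN f hf A hA ⟨hr, h⟩
        filter_upwards [this] with m hm
        simpa [hr, Function.comp_def] using hm
      · exact Eventually.of_forall fun m h => hr h.1
    · exact eventually_forall_mem fun e he => eventually_freshVal_ne (h₃ e he)
  have hc : ∀ a, freshVal m (resolve b.sub (.const a)) = a := fun a => by
    rw [hs.resolve_const]; rfl
  have hE := fun A => val_ofElem (val := fun x => freshVal m (resolve b.sub x)) hc A
  refine ⟨_, ⟨b.copies.length, by simp [Branch.copies],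
    fun k => freshVal m (resolve b.sub (.clo k)),
    fun i k => freshVal m (resolve b.sub (.opn (b.copies.get i) k)), ?_, rfl⟩,
    fun x => freshVal m (resolve b.sub x), hc, ?_⟩
  · intro d hd
    obtain ⟨e, he, h⟩ := h₁ d hd
    refine ⟨e, he, fun i j => ?_⟩
    rw [hE, hE]
    exact h _ (b.copies.get_mem i) _ (b.copies.get_mem j)
  · refine ⟨by simp [hb], fun e he => congrArg _ (hs.resolve_eq he), ?_, ?_, h₃⟩
    · intro A hA f hf
      obtain ⟨i, hi⟩ := List.get_of_mem (a := A) (l := b.copies) (List.mem_cons_of_mem _ hA)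
      refine ⟨i, f, hf, ?_⟩
      simp only [hi]
      congr 1
      exact funext fun e => (hE A e).symm
    · rintro N hN ⟨i, f, hf, h⟩
      rw [inst_eq (val := fun x => freshVal m (resolve b.sub x)) hc, Fact.map,
        Fact.mk.injEq] at h
      refine h₂ N hN f hf _ (b.copies.get_mem i) ⟨h.1, h.2.trans ?_⟩
      exact List.map_congr_left fun e _ => hE _ e

/-- A branch is accepted if it holds for an instance that the table represents. Here `c` says which
of the valuations of the open nulls is used for an atom. -/
theorem Branch.accepts_of_holds {T : CondTable} {b : Branch} {J : Set (Fact Cons)}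
    {val : Node → Cons} {n : ℕ} {v : ℕ → Cons} {w : Fin n → ℕ → Cons} {c : Atom → Fin n}
    (hc : ∀ a, val (.const a) = a) (hv : ∀ k, val (.clo k) = v k)
    (hw : ∀ A k, val (.opn A k) = w (c A) k) (hT : T.SatCond v w)
    (hJ : ∀ A, ∀ f ∈ T.facts, f.map (fun e => val (.ofElem A e)) ∈ J)
    (hb : b.Holds T J val) : b.accepts T = true := by
  have hr := val_resolve hb.sub
  simp only [Branch.accepts, Bool.and_eq_true, List.all_eq_true, List.any_eq_true,
    decide_eq_true_eq]
  refine ⟨fun d hd => ?_, fun N hN f hf A _ h => ?_, fun e he h => ?_⟩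
  · obtain ⟨e, he, h⟩ := hT d hd
    refine ⟨e, he, fun A _ B _ hAB => h (c A) (c B) ?_⟩
    have hAB := congrArg val hAB
    rw [hr, hr, ← val_ofElem hc, ← val_ofElem hc] at hAB
    simpa only [hv, hw] using hAB
  · refine hb.negRel N hN ?_
    have := congrArg (List.map val) h.2
    simp only [List.map_map, Function.comp_def, hr] at this
    rw [inst_eq hc, this, h.1]
    exact hJ A f hf
  · have := congrArg val h
    rw [hr, hr] at this
    exact hb.negEq e he this

/-! ### The answer of the tableau -/

/-- The state of the tableau after `i` rounds. -/
def tableau (q : UniversalQuery) (T : CondTable) (ts : List Cons) (i : ℕ) :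
    CondTable × List Branch :=
  tableauStep^[i] (initial (q, T, ts))

section

variable {q : UniversalQuery} {T : CondTable} {ts : List Cons}

theorem tableau_fst (i : ℕ) : (tableau q T ts i).1 = T := by
  induction i with
  | zero => rfl
  | succ i ih => rw [tableau, Function.iterate_succ_apply']; exact ih

theorem mem_tableau_zero {b : Branch} :
    b ∈ (tableau q T ts 0).2 ↔
      b = ⟨[.bind 0 ts, .formula false q.matrix], [], [], [], []⟩ :=
  List.mem_singleton

theorem mem_tableau_succ {i : ℕ} {b : Branch} :
    b ∈ (tableau q T ts (i + 1)).2 ↔ ∃ b₀ ∈ (tableau q T ts i).2, b ∈ b₀.step T := by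
  rw [tableau, Function.iterate_succ_apply', ← tableau, tableauStep, tableau_fst,
    List.mem_flatMap]

theorem weight_tableau (i : ℕ) :
    ∀ b ∈ (tableau q T ts i).2, b.weight ≤ 1 + 2 * ts.length + q.matrix.weight - i := by
  induction i with
  | zero =>
    intro b hb
    rw [mem_tableau_zero.1 hb]
    simp [Branch.weight, Obligation.weight]
  | succ i ih =>
    intro b hb
    obtain ⟨b₀, hb₀, h⟩ := mem_tableau_succ.1 hb
    have := ih b₀ hb₀
    have := Branch.weight_step h
    omega

theorem tableauOpen_eq_false :
    tableauOpen (tableau q T ts (1 + 2 * ts.length + q.matrix.weight)) = false := by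
  rw [tableauOpen, List.any_eq_false]
  intro b hb
  have := weight_tableau _ b hb
  cases h : b.todo with
  | nil => simp
  | cons o os =>
    have := o.weight_pos
    simp only [Branch.weight, h, List.map_cons, List.sum_cons] at *
    omega

theorem triangular_tableau (i : ℕ) : ∀ b ∈ (tableau q T ts i).2, Triangular b.sub := by
  induction i with
  | zero =>
    intro b hb
    rw [mem_tableau_zero.1 hb]
    trivial
  | succ i ih =>
    intro b hb
    obtain ⟨b₀, hb₀, h⟩ := mem_tableau_succ.1 hb
    exact Branch.triangular_step h (ih b₀ hb₀)

/-- The assignment extends the tuple and makes the matrix of the query false in `J`. -/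
def IsCounterexample (q : UniversalQuery) (ts : List Cons) (J : Set (Fact Cons))
    (ν : ℕ → Cons) : Prop :=
  (∀ j a, ts[j]? = some a → ν j = a) ∧ ¬ q.matrix.Holds J ν

theorem holds_initial {J : Set (Fact Cons)} {val : Node → Cons} :
    Branch.Holds T J val ⟨[.bind 0 ts, .formula false q.matrix], [], [], [], []⟩ ↔
      IsCounterexample q ts J fun x => val (.var x) := by
  refine ⟨fun h => ?_, fun h => ⟨?_, ?_, ?_, ?_, ?_⟩⟩
  · have h := h.todo
    simpa [Obligation.Holds, IsCounterexample] using h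
  all_goals simp
  simpa [Obligation.Holds, IsCounterexample] using h

theorem isCounterexample_of_holds {J : Set (Fact Cons)} {val : Node → Cons}
    (hc : ∀ a, val (.const a) = a) (i : ℕ) :
    ∀ b ∈ (tableau q T ts i).2, b.Holds T J val →
      IsCounterexample q ts J fun x => val (.var x) := by
  induction i with
  | zero =>
    intro b hb h
    rw [mem_tableau_zero.1 hb] at h
    exact holds_initial.1 h
  | succ i ih =>
    intro b hb h
    obtain ⟨b₀, hb₀, hs⟩ := mem_tableau_succ.1 hb
    exact ih b₀ hb₀ (h.of_step hc hs)

theorem exists_holds_tableau {J : Set (Fact Cons)} {val : Node → Cons}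
    (hc : ∀ a, val (.const a) = a)
    (hJ : ∀ A, ∀ f ∈ T.facts, f.map (fun e => val (.ofElem A e)) ∈ J)
    (hA : ∀ A : Atom, A.inst (fun x => val (.var x)) ∈ J →
      ∃ f ∈ T.facts, A.inst (fun x => val (.var x)) = f.map (fun e => val (.ofElem A e)))
    (h : IsCounterexample q ts J fun x => val (.var x)) (i : ℕ) :
    ∃ b ∈ (tableau q T ts i).2, b.Holds T J val := by
  induction i with
  | zero => exact ⟨_, mem_tableau_zero.2 rfl, holds_initial.2 h⟩
  | succ i ih =>
    obtain ⟨b, hb, hh⟩ := ih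
    obtain ⟨b', hb', hh'⟩ := hh.step hc hJ hA
    exact ⟨b', mem_tableau_succ.2 ⟨b, hb, hb'⟩, hh'⟩

/-- Once no obligations remain, the tableau accepts if and only if there is no counterexample. -/
theorem tableauAnswer_iff {i : ℕ} (hi : tableauOpen (tableau q T ts i) = false) :
    tableauAnswer (tableau q T ts i) = true ↔
      ∀ J ∈ T.Rep, ∀ ν, ¬ IsCounterexample q ts J ν := by
  rw [tableauAnswer, tableau_fst, Bool.not_eq_true', List.any_eq_false]
  rw [tableauOpen, List.any_eq_false] at hi
  classical
  constructor
  · rintro h _ ⟨n, hn, v, w, hT, rfl⟩ ν hν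
    -- the copy for a true atom is a valuation that makes it a fact of the instance
    let c : Atom → Fin n := fun A =>
      if hA : ∃ i : Fin n, ∃ f ∈ T.facts, A.inst ν = f.map (Elem.val v (w i)) then hA.choose
      else ⟨0, hn⟩
    let val : Node → Cons
      | .const a => a
      | .var x => ν x
      | .clo k => v k
      | .opn A k => w (c A) k
    have hE : ∀ A, (fun e => val (.ofElem A e)) = Elem.val v (w (c A)) := fun A =>
      funext fun e => by cases e <;> rfl
    have hJ : ∀ A, ∀ f ∈ T.facts, f.map (fun e => val (.ofElem A e)) ∈
        {g | ∃ i : Fin n, ∃ f ∈ T.facts, g = f.map (Elem.val v (w i))} := fun A f hf =>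
      ⟨c A, f, hf, by rw [hE]⟩
    obtain ⟨b, hb, hh⟩ := exists_holds_tableau (q := q) (ts := ts) (val := val)
      (fun _ => rfl) hJ (fun A hA => by
        have hA : ∃ i : Fin n, ∃ f ∈ T.facts, A.inst ν = f.map (Elem.val v (w i)) := hA
        have : c A = hA.choose := dif_pos hA
        rw [hE, this]
        exact hA.choose_spec) hν i
    exact h b hb (Branch.accepts_of_holds (c := c) (fun _ => rfl) (fun _ => rfl)
      (fun _ _ => rfl) hT hJ hh)
  · intro h b hb ha
    have hbt : b.todo = [] := by simpa using hi b hb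
    obtain ⟨J, hJ, val, hc, hh⟩ := Branch.exists_holds hbt (triangular_tableau i b hb) ha
    exact h J hJ _ (isCounterexample_of_holds hc i b hb hh)

end

theorem mem_certain_iff (q : UniversalQuery) (T : CondTable) (t : Fin q.arity → Cons) :
    t ∈ ⋂ J ∈ T.Rep, q.answers J ↔
      ∀ J ∈ T.Rep, ∀ ν, ¬ IsCounterexample q (List.ofFn t) J ν := by
  simp only [Set.mem_iInter, UniversalQuery.answers, Set.mem_ofPred_eq, IsCounterexample,
    not_and, not_not]
  refine forall₂_congr fun J _ => forall_congr' fun ν => imp_congr_left ?_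
  constructor
  · intro h j a hj
    rw [List.getElem?_ofFn] at hj
    split_ifs at hj with hlt
    have hj := Option.some.inj hj
    exact (h ⟨j, hlt⟩).trans hj
  · intro h i
    exact h i (t i) (by simp)

end DataExchange

theorem theorem10 :
    ∃ P : DataExchange.Prog, ∀ q : DataExchange.UniversalQuery, ∃ p : Polynomial ℕ,
      ∀ (M : DataExchange.Mapping) (I : Set (DataExchange.Fact DataExchange.Cons))
        (T : DataExchange.CondTable) (t : Fin q.arity → DataExchange.Cons),
        M.WellFormed → M.Safe → M.density = 1 →
        DataExchange.IsInstance M.source I →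
        DataExchange.IsUniversalRepresentative M I T →
        q.Over M.target →
        P.AnswersWithin
          (DataExchange.Tree.cons (DataExchange.encQuery q) (DataExchange.encData T t))
          (p.eval (DataExchange.encData T t).size)
          (t ∈ ⋂ J ∈ T.Rep, q.answers J) := by
  obtain ⟨P, hP⟩ := DataExchange.exists_slicewise_loop DataExchange.PolyTime.initial
    DataExchange.PolyTime.tableauStep DataExchange.PolyTime.tableauOpen
    DataExchange.PolyTime.tableauAnswer
  refine ⟨P, fun q => ?_⟩
  obtain ⟨p, hp⟩ := hP q (1 + 2 * q.arity + q.matrix.weight)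
  refine ⟨p, fun M I T t _ _ _ _ _ _ => ?_⟩
  have hopen := DataExchange.tableauOpen_eq_false (q := q) (T := T) (ts := List.ofFn t)
  rw [List.length_ofFn] at hopen
  obtain ⟨i, -, hi, c, hc, hr⟩ := hp (T, List.ofFn t) hopen
  refine ⟨_, c, hr, hc, ?_⟩
  rw [DataExchange.mem_certain_iff, ← DataExchange.tableauAnswer_iff hi]
  change _ ↔ DataExchange.tableauAnswer (DataExchange.tableauStep^[i] _) = true
  cases DataExchange.tableauAnswer (DataExchange.tableauStep^[i] _) <;> simp
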